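/- Let $t_0\in\mathbb R$ and let $a,b,c:[t_0,\infty)\to\mathbb R$ be continuous with $a(t)\ge 0$, $c(t)\ge 0$ for $t\ge t_0$, where $a$ and $c$ have unbounded supports (neither vanishes identically on any half-line $[T,\infty)$). Consider the Riccati equation $$x'+a(t)x^2+b(t)x+c(t)=0,\qquad t\ge t_0. \tag{R}$$ For $t_1\ge t_0$, a real solution of (R) is called $t_1$-regular if it exists on $[t_1,\infty)$. A $t_1$-regular solution $x$ is called $t_1$-normal if there is a neighbourhood $U$ of $x(t_1)$ such that every solution $\tilde x$ of (R) with $\tilde x(t_1)\in U$ is $t_1$-regular; otherwise it is called $t_1$-extremal. Put $$J_u(t_1;t)=\exp\Big\{\int_{t_1}^t u(s)\,ds\Big\},\quad I^+_{u,v}(t_1)=\int_{t_1}^{\infty}u(\tau)J_{-v}(t_1;\tau)\,d\tau,\quad I^-_{u,v}(t_1;t)=\int_{t_1}^tJ_{-u}(\tau;t)v(\tau)\,d\tau .$$ All integrals over $[t_0,\infty)$ are improper, $\int_{t_0}^\infty=\lim_{T\to\infty}\int_{t_0}^T$. **Theorem 2.4.** Suppose that (R) has a $t_0$-regular solution. Then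 (R) has a unique $t_0$-extremal solution $x_*$, and the following assertions hold. **I.** Suppose $I^+_{a,b}(t_0)=+\infty$. Then every $t_0$-regular solution of (R) is positive on $[t_0,\infty)$, and $\int_{t_0}^\infty a\,x_N\,d\tau=+\infty$ for every $t_0$-normal solution $x_N$. If in addition $\int_{t_0}^\infty c(\tau)I^-_{-b,a}(t_0;\tau)\,d\tau=+\infty$, then also $\int_{t_0}^\infty a\,x_*\,d\tau=+\infty$. **II.** Suppose $I^+_{c,-b}(t_0)=+\infty$. Let $x$ be a $t_0$-regular solution. If $x(t_0)>0$, there exist $t_2\ge t_1>t_0$ such that $x>0$ on $[t_0,t_1)$, $x=0$ on $[t_1,t_2]$ and $x<0$ on $(t_2,\infty)$. If $x(t_0)=0$, there exists $t_1\ge t_0$ such that $x=0$ on $[t_0,t_1]$ and $x<0$ on $(t_1,\infty)$. If $x(t_0)<0$, then $x<0$ on $[t_0,\infty)$. Moreover $\int_{t_0}^\infty a\,x_*\,d\tau=-\infty$. If in addition $\int_{t_0}^\infty a(\tau)I^-_{b,c}(t_0;\tau)\,d\tau=+\infty$, then $\int_{t_0}^\infty a\,x_N\,d\tau=-\infty$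 for every $t_0$-normal solution $x_N$. **III.** Suppose $I^+_{a,b}(t_0)<+\infty$ and $I^+_{c,-b}(t_0)<+\infty$. Then there exist $t_2\ge t_1\ge t_0$ such that: * $x_*(t)<0$ for $t\ge t_1$, and the solutions $x$ of (R) with $x(t_1)\in(x_*(t_1),0)$ are $t_0$-regular and satisfy $x(t)<0$ for $t\ge t_1$; * the solutions $x$ of (R) with $x(t_2)\in(x_*(t_2),0)$ are $t_2$-regular and satisfy $x(t)<0$ for $t\ge t_2$; * there is a $t_2$-normal solution $x_N^+$, positive on $[t_2,\infty)$, such that every solution $x$ of (R) with $x(t_2)\in(0,x_N^+(t_2))$ is $t_2$-regular and there exist $t_4\ge t_3>t_2$ (depending on $x$) with $x>0$ on $[t_2,t_3)$, $x=0$ on $[t_3,t_4]$ and $x<0$ on $(t_4,\infty)$; * the solution $x$ of (R) with $x(t_2)=0$ is $t_2$-regular and there is $t_3\ge t_2$ with $x=0$ on $[t_2,t_3]$ and $x<0$ on $(t_3,\infty)$; * every solution $x$ of (R) with $x(t_2)<0$ is negative for all $t\ge t_2$ at which it exists. Moreover $\int_{t_0}^\infty a\,x_N\,d\tau$ converges (to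 a real number) for every $t_0$-normal solution $x_N$, and $\int_{t_0}^\infty a\,x_*\,d\tau=-\infty$. -/

import Mathlib

open Set Filter Topology

noncomputable section

namespace Riccati

/-- `x` solves `x' + a x² + b x + c = 0` on the set `s` (an interval); at an end point which
belongs to `s` the derivative is one-sided. -/
def IsSolutionOn (a b c : ℝ → ℝ) (x : ℝ → ℝ) (s : Set ℝ) : Prop :=
  ∀ t ∈ s, HasDerivWithinAt x (-(a t * x t ^ 2 + b t * x t + c t)) s t

/-- A `t₁`-regular solution: a solution which exists on `[t₁, ∞)`. -/
def IsRegular (a b c : ℝ → ℝ) (t₁ : ℝ) (x : ℝ → ℝ) : Prop :=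
  IsSolutionOn a b c x (Ici t₁)

/-- `reg(t₁)`: the initial values at `t₁` for which the solution is `t₁`-regular. -/
def reg (a b c : ℝ → ℝ) (t₁ : ℝ) : Set ℝ :=
  {v | ∃ x, IsRegular a b c t₁ x ∧ x t₁ = v}

/-- A `t₁`-regular solution is `t₁`-normal if every solution whose value at `t₁` lies in some
neighbourhood of `x t₁` is `t₁`-regular. -/
def IsNormal (a b c : ℝ → ℝ) (t₁ : ℝ) (x : ℝ → ℝ) : Prop :=
  IsRegular a b c t₁ x ∧ ∃ U ∈ 𝓝 (x t₁), U ⊆ reg a b c t₁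

/-- A `t₁`-regular solution which is not `t₁`-normal is `t₁`-extremal. -/
def IsExtremal (a b c : ℝ → ℝ) (t₁ : ℝ) (x : ℝ → ℝ) : Prop :=
  IsRegular a b c t₁ x ∧ ¬ IsNormal a b c t₁ x

/-- `J_u(t₁;t) = exp (∫_{t₁}^t u)`. -/
def J (u : ℝ → ℝ) (t₁ t : ℝ) : ℝ := Real.exp (∫ s in t₁..t, u s)

/-- The integrand `u(τ) J_{-v}(t₁;τ)` of `I⁺_{u,v}(t₁) = ∫_{t₁}^∞ u(τ) J_{-v}(t₁;τ) dτ`. -/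
def IPlusIntegrand (u v : ℝ → ℝ) (t₁ τ : ℝ) : ℝ := u τ * J (fun s => -v s) t₁ τ

/-- `I⁻_{u,v}(t₁;t) = ∫_{t₁}^t J_{-u}(τ;t) v(τ) dτ`. -/
def IMinus (u v : ℝ → ℝ) (t₁ t : ℝ) : ℝ := ∫ τ in t₁..t, J (fun s => -u s) τ t * v τ

/-- The improper integral `∫_{t₁}^∞ f` converges (to a real number). -/
def IntegralConverges (f : ℝ → ℝ) (t₁ : ℝ) : Prop :=
  ∃ l : ℝ, Tendsto (fun T => ∫ τ in t₁..T, f τ) atTop (𝓝 l)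

/-- The improper integral `∫_{t₁}^∞ f` equals `+∞`. -/
def IntegralEqTop (f : ℝ → ℝ) (t₁ : ℝ) : Prop :=
  Tendsto (fun T => ∫ τ in t₁..T, f τ) atTop atTop

/-- The improper integral `∫_{t₁}^∞ f` equals `-∞`. -/
def IntegralEqBot (f : ℝ → ℝ) (t₁ : ℝ) : Prop :=
  Tendsto (fun T => ∫ τ in t₁..T, f τ) atTop atBot

/-- `f` has unbounded support in `[t₀, ∞)`. -/
def UnboundedSupport (f : ℝ → ℝ) (t₀ : ℝ) : Prop :=
  ∀ T, ∃ t, t₀ ≤ t ∧ T ≤ t ∧ f t ≠ 0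

end Riccati

end

namespace Riccati

/-! ### Calculus on a half-line with one-sided derivatives. -/

section Calculus

variable {f g f' g' : ℝ → ℝ} {T : ℝ}

/-! The Riccati equation is linearised. With `φ = exp ∫ a x` and `z = x φ J_b` it becomes `φ' = A
z`, `z' = -C φ`, where `A = a / J_b` and `C = c J_b` are exactly the integrands of `I⁺_{a,b}` and
`I⁺_{c,-b}`. Then `z` has the sign of `x` and is nonincreasing, and `∫ a x = log φ`, so the theorem
is about the sign of `z` and the limit of `φ`.

By d'Alembert reduction (`LinSol.reduction`, `LinSol.eq_reduction`), every other regular solution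
has first component `φ (1 + κ q)` with `q = ∫ A / φ²` and `κ` proportional to the difference of
initial values. An initial value is thus regular exactly when `1 + κ q` stays positive. As `q` is
nondecreasing and never reaches its supremum, the regular values form a closed half-line
(`exists_least_regular`). Its end point is the extremal solution, for which `q` is unbounded; for
normal solutions `q` is bounded.

If `z` is ever negative, positivity of `φ` forces `∫ A` to be bounded. So `∫ A = ∞` makes every `z`
positive and `φ` nondecreasing, and bounded `q` then forces `φ → ∞`. If `∫ C = ∞`, then `z` becomes
negative, `∫ A` is bounded, and unbounded `q` forces `φ → 0`. If both integrals converge, unbounded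
`q` still makes `z` negative and `φ → 0`, while bounded `q` gives `φ` a positive limit. The local
picture in that case comes from solving the reduction backwards (`IsRegular.exists_backward`) and
from the least `κ` keeping `z` nonnegative (`IsRegular.exists_threshold`). -/

theorem hasDerivWithinAt_integral (hf : ContinuousOn f (Ici T)) {t : ℝ} (ht : T ≤ t) :
    HasDerivWithinAt (fun t => ∫ s in T..t, f s) (f t) (Ici T) t := by
  -- Freezing `f` to the left of `T` gives a function continuous on the whole line, to which the
  -- two-sided fundamental theorem applies.
  have hg : Continuous (fun s => f (max T s)) :=
    hf.comp_continuous (by fun_prop) fun s => mem_Ici.2 (le_max_left _ _)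
  have h := (intervalIntegral.integral_hasDerivAt_right (hg.intervalIntegrable T t)
    hg.stronglyMeasurable.stronglyMeasurableAtFilter hg.continuousAt).hasDerivWithinAt (s := Ici T)
  simp only [max_eq_right ht] at h
  have key : ∀ u ∈ Ici T, ∫ s in T..u, f s = ∫ s in T..u, f (max T s) := by
    intro u hu
    refine intervalIntegral.integral_congr fun s hs => ?_
    rw [uIcc_of_le hu] at hs
    simp only [max_eq_right hs.1]
  exact h.congr key (key t ht)

theorem monotoneOn_Ici_of_deriv_nonneg
    (hf : ∀ t, T ≤ t → HasDerivWithinAt f (f' t) (Ici T) t) (h : ∀ t, T ≤ t → 0 ≤ f' t) :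
    MonotoneOn f (Ici T) :=
  monotoneOn_of_hasDerivWithinAt_nonneg (convex_Ici T)
    (fun t ht => (hf t ht).continuousWithinAt)
    (fun t ht => (hf t (interior_subset ht)).mono interior_subset)
    fun t ht => h t (interior_subset ht)

theorem le_of_deriv_le (hf : ∀ t, T ≤ t → HasDerivWithinAt f (f' t) (Ici T) t)
    (hg : ∀ t, T ≤ t → HasDerivWithinAt g (g' t) (Ici T) t)
    (h : ∀ t, T ≤ t → f' t ≤ g' t) (h0 : f T ≤ g T) {t : ℝ} (ht : T ≤ t) : f t ≤ g t := by
  have := monotoneOn_Ici_of_deriv_nonneg (fun t ht => (hg t ht).sub (hf t ht))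
    (fun t ht => sub_nonneg.2 (h t ht)) self_mem_Ici (mem_Ici.2 ht) ht
  simp only [Pi.sub_apply] at this
  linarith

theorem eq_of_deriv_eq (hf : ∀ t, T ≤ t → HasDerivWithinAt f (f' t) (Ici T) t)
    (hg : ∀ t, T ≤ t → HasDerivWithinAt g (g' t) (Ici T) t)
    (h : ∀ t, T ≤ t → f' t = g' t) (h0 : f T = g T) {t : ℝ} (ht : T ≤ t) : f t = g t :=
  le_antisymm (le_of_deriv_le hf hg (fun t ht => (h t ht).le) h0.le ht)
    (le_of_deriv_le hg hf (fun t ht => (h t ht).ge) h0.ge ht)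

theorem integral_nonneg_Ici (h0 : ∀ t, T ≤ t → 0 ≤ f t) {t : ℝ} (ht : T ≤ t) :
    0 ≤ ∫ s in T..t, f s :=
  intervalIntegral.integral_nonneg ht fun s hs => h0 s hs.1

theorem monotoneOn_integral (hf : ContinuousOn f (Ici T)) (h0 : ∀ t, T ≤ t → 0 ≤ f t) :
    MonotoneOn (fun t => ∫ s in T..t, f s) (Ici T) :=
  monotoneOn_Ici_of_deriv_nonneg (fun _ ht => hasDerivWithinAt_integral hf ht) h0

theorem intervalIntegrable_of_Ici (hf : ContinuousOn f (Ici T)) {s t : ℝ} (hs : T ≤ s)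
    (ht : T ≤ t) : IntervalIntegrable f MeasureTheory.volume s t :=
  (hf.mono fun _ hu => (le_inf hs ht).trans hu.1).intervalIntegrable

theorem tendsto_atTop_of_monotoneOn_Ici (hf : MonotoneOn f (Ici T))
    (h : ∀ M, ∃ t, T ≤ t ∧ M ≤ f t) : Tendsto f atTop atTop := by
  refine tendsto_atTop.2 fun M => ?_
  obtain ⟨t, ht, hM⟩ := h M
  filter_upwards [eventually_ge_atTop t] with u hu
  exact hM.trans (hf ht (ht.trans hu) hu)

theorem exists_tendsto_of_monotoneOn_Ici (hf : MonotoneOn f (Ici T)) {M : ℝ}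
    (h : ∀ t, T ≤ t → f t ≤ M) : ∃ l, Tendsto f atTop (𝓝 l) := by
  have hm : Monotone fun t => f (max T t) := fun s t hst =>
    hf (mem_Ici.2 (le_max_left _ _)) (mem_Ici.2 (le_max_left _ _)) (max_le_max le_rfl hst)
  refine ⟨_, (tendsto_atTop_ciSup hm
    ⟨M, by rintro _ ⟨t, rfl⟩; exact h _ (le_max_left _ _)⟩).congr' ?_⟩
  filter_upwards [eventually_ge_atTop T] with t ht
  rw [max_eq_right ht]

theorem exists_tendsto_of_antitoneOn_Ici (hf : AntitoneOn f (Ici T)) {m : ℝ}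
    (h : ∀ t, T ≤ t → m ≤ f t) : ∃ l, Tendsto f atTop (𝓝 l) := by
  obtain ⟨l, hl⟩ := exists_tendsto_of_monotoneOn_Ici hf.neg (M := -m)
    fun t ht => neg_le_neg (h t ht)
  exact ⟨-l, by simpa using hl.neg⟩

/-- A convergent improper integral of a nonnegative function has bounded partial integrals. -/
theorem IntegralConverges.exists_le (h : IntegralConverges f T) (hf : ContinuousOn f (Ici T))
    (h0 : ∀ t, T ≤ t → 0 ≤ f t) :
    ∃ l, Tendsto (fun t => ∫ s in T..t, f s) atTop (𝓝 l) ∧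
      ∀ t, T ≤ t → ∫ s in T..t, f s ≤ l := by
  obtain ⟨l, hl⟩ := h
  refine ⟨l, hl, fun t ht => ge_of_tendsto hl ?_⟩
  filter_upwards [eventually_ge_atTop t] with u hu
  exact monotoneOn_integral hf h0 ht (ht.trans hu) hu

/-- The sign pattern of a nonincreasing continuous function which is nonnegative at first and
negative later. -/
theorem exists_sign_pattern (hf : AntitoneOn f (Ici T)) (hc : ContinuousOn f (Ici T))
    (h0 : 0 ≤ f T) {s : ℝ} (hs : T ≤ s) (hneg : f s < 0) :
    ∃ p q, T ≤ p ∧ (0 < f T → T < p) ∧ (f T = 0 → p = T) ∧ p ≤ q ∧ (∀ t ∈ Ico T p, 0 < f t) ∧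
      (∀ t ∈ Icc p q, f t = 0) ∧ ∀ t, q < t → f t < 0 := by
  set Z := Icc T s ∩ f ⁻¹' {0} with hZ
  have hcs : ContinuousOn f (Icc T s) := hc.mono Icc_subset_Ici_self
  have hcomp : IsCompact Z :=
    isCompact_Icc.of_isClosed_subset (hcs.preimage_isClosed_of_isClosed isClosed_Icc
      isClosed_singleton) inter_subset_left
  have hne : Z.Nonempty := by
    obtain ⟨t, ht, h⟩ := intermediate_value_Icc' hs hcs ⟨hneg.le, h0⟩
    exact ⟨t, ht, h⟩
  obtain ⟨p, hp, hpmin⟩ := hcomp.exists_isLeast hne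
  obtain ⟨q, hq, hqmax⟩ := hcomp.exists_isGreatest hne
  have hp0 : f p = 0 := hp.2
  have hq0 : f q = 0 := hq.2
  refine ⟨p, q, hp.1.1, fun h => lt_of_le_of_ne hp.1.1 ?_, fun h => ?_, hpmin hq, ?_, ?_, ?_⟩
  · rintro rfl
    exact h.ne' hp0
  · exact le_antisymm (hpmin ⟨⟨le_rfl, hs⟩, h⟩) hp.1.1
  · intro t ht
    refine lt_of_le_of_ne (hp0 ▸ hf ht.1 hp.1.1 ht.2.le) fun h => ?_
    exact absurd (hpmin ⟨⟨ht.1, ht.2.le.trans hp.1.2⟩, h.symm⟩) (not_le.2 ht.2)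
  · intro t ht
    have hTt : T ≤ t := hp.1.1.trans ht.1
    exact le_antisymm (hp0 ▸ hf hp.1.1 hTt ht.1) (hq0 ▸ hf hTt hq.1.1 ht.2)
  · intro t ht
    have hTt : T ≤ t := hq.1.1.trans ht.le
    refine lt_of_le_of_ne (hq0 ▸ hf hq.1.1 hTt ht.le) fun h => ?_
    rcases le_total t s with hts | hts
    · exact absurd (hqmax ⟨⟨hTt, hts⟩, h⟩) (not_le.2 ht)
    · have := hf hs hTt hts
      linarith

end Calculus

/-- `(φ, z)` solves the linear system `φ' = A z`, `z' = -C φ` on `[T, ∞)` and `φ > 0` there. -/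
structure LinSol (A C : ℝ → ℝ) (T : ℝ) (φ z : ℝ → ℝ) : Prop where
  pos : ∀ t, T ≤ t → 0 < φ t
  deriv_fst : ∀ t, T ≤ t → HasDerivWithinAt φ (A t * z t) (Ici T) t
  deriv_snd : ∀ t, T ≤ t → HasDerivWithinAt z (-(C t * φ t)) (Ici T) t

/-- `∫_T^t A / φ²`. -/
noncomputable def quad (A φ : ℝ → ℝ) (T t : ℝ) : ℝ := ∫ s in T..t, A s / φ s ^ 2

/-! ### The linear system: reduction, growth bounds and asymptotics. -/

section Linear

variable {A C φ z ψ ζ : ℝ → ℝ} {T : ℝ}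

namespace LinSol

theorem mono (S : LinSol A C T φ z) {s : ℝ} (hs : T ≤ s) : LinSol A C s φ z where
  pos t ht := S.pos t (hs.trans ht)
  deriv_fst t ht := (S.deriv_fst t (hs.trans ht)).mono (Ici_subset_Ici.2 hs)
  deriv_snd t ht := (S.deriv_snd t (hs.trans ht)).mono (Ici_subset_Ici.2 hs)

theorem continuousOn_fst (S : LinSol A C T φ z) : ContinuousOn φ (Ici T) :=
  fun t ht => (S.deriv_fst t ht).continuousWithinAt

theorem continuousOn_snd (S : LinSol A C T φ z) : ContinuousOn z (Ici T) :=
  fun t ht => (S.deriv_snd t ht).continuousWithinAt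

theorem antitoneOn_snd (S : LinSol A C T φ z) (hC0 : ∀ t, T ≤ t → 0 ≤ C t) :
    AntitoneOn z (Ici T) := by
  have := monotoneOn_Ici_of_deriv_nonneg (fun t ht => (S.deriv_snd t ht).neg)
    fun t ht => by simpa using mul_nonneg (hC0 t ht) (S.pos t ht).le
  simpa using this.neg

theorem monotoneOn_fst (S : LinSol A C T φ z) (hA0 : ∀ t, T ≤ t → 0 ≤ A t)
    (hz : ∀ t, T ≤ t → 0 ≤ z t) : MonotoneOn φ (Ici T) :=
  monotoneOn_Ici_of_deriv_nonneg S.deriv_fst fun t ht => mul_nonneg (hA0 t ht) (hz t ht)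

theorem antitoneOn_fst (S : LinSol A C T φ z) (hA0 : ∀ t, T ≤ t → 0 ≤ A t)
    (hz : ∀ t, T ≤ t → z t ≤ 0) : AntitoneOn φ (Ici T) := by
  have := monotoneOn_Ici_of_deriv_nonneg (fun t ht => (S.deriv_fst t ht).neg)
    fun t ht => by
      have := mul_nonneg (hA0 t ht) (neg_nonneg.2 (hz t ht))
      linarith
  simpa using this.neg

theorem continuousOn_div (S : LinSol A C T φ z) (hA : ContinuousOn A (Ici T)) :
    ContinuousOn (fun s => A s / φ s ^ 2) (Ici T) :=
  hA.div (S.continuousOn_fst.pow 2) fun t ht => (pow_pos (S.pos t ht) 2).ne'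

theorem hasDerivWithinAt_quad (S : LinSol A C T φ z) (hA : ContinuousOn A (Ici T)) {t : ℝ}
    (ht : T ≤ t) : HasDerivWithinAt (quad A φ T) (A t / φ t ^ 2) (Ici T) t :=
  hasDerivWithinAt_integral (S.continuousOn_div hA) ht

theorem div_nonneg (S : LinSol A C T φ z) (hA0 : ∀ t, T ≤ t → 0 ≤ A t) :
    ∀ t, T ≤ t → 0 ≤ A t / φ t ^ 2 :=
  fun t ht => _root_.div_nonneg (hA0 t ht) (pow_pos (S.pos t ht) 2).le

theorem quad_nonneg (S : LinSol A C T φ z) (hA0 : ∀ t, T ≤ t → 0 ≤ A t) {t : ℝ} (ht : T ≤ t) :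
    0 ≤ quad A φ T t :=
  integral_nonneg_Ici (S.div_nonneg hA0) ht

theorem monotoneOn_quad (S : LinSol A C T φ z) (hA : ContinuousOn A (Ici T))
    (hA0 : ∀ t, T ≤ t → 0 ≤ A t) : MonotoneOn (quad A φ T) (Ici T) :=
  monotoneOn_integral (S.continuousOn_div hA) (S.div_nonneg hA0)

/-- `quad` exceeds each of its values later on. -/
theorem exists_quad_lt (S : LinSol A C T φ z) (hA : ContinuousOn A (Ici T))
    (hA0 : ∀ t, T ≤ t → 0 ≤ A t) (hsupp : UnboundedSupport A T) {t : ℝ} (ht : T ≤ t) :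
    ∃ u, t ≤ u ∧ quad A φ T t < quad A φ T u := by
  by_contra! hcon
  -- Otherwise `quad` is constant from `t` on, so its right derivative vanishes at a later point
  -- where `A` does not.
  obtain ⟨u, hu, htu, hAu⟩ := hsupp t
  have hconst : ∀ r ∈ Ici u, quad A φ T r = quad A φ T t := fun r hr =>
    le_antisymm (hcon r (htu.trans hr))
      (S.monotoneOn_quad hA hA0 ht (ht.trans (htu.trans hr)) (htu.trans hr))
  have h1 : HasDerivWithinAt (quad A φ T) (A u / φ u ^ 2) (Ici u) u :=
    (S.hasDerivWithinAt_quad hA hu).mono (Ici_subset_Ici.2 hu)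
  have h2 : HasDerivWithinAt (quad A φ T) 0 (Ici u) u :=
    (hasDerivWithinAt_const u (Ici u) (quad A φ T t)).congr hconst (hconst u self_mem_Ici)
  have h3 := (uniqueDiffOn_Ici u u self_mem_Ici).eq_deriv _ h1 h2
  exact div_ne_zero hAu (pow_pos (S.pos u hu) 2).ne' h3

/-- Once nonpositive, `z` becomes negative. -/
theorem exists_neg (S : LinSol A C T φ z) (hC0 : ∀ t, T ≤ t → 0 ≤ C t)
    (hsupp : UnboundedSupport C T) {s : ℝ} (hs : T ≤ s) (hz : z s ≤ 0) :
    ∃ u, s ≤ u ∧ z u < 0 := by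
  by_contra! hcon
  obtain ⟨u, hu, hsu, hCu⟩ := hsupp s
  have hconst : ∀ r ∈ Ici u, z r = 0 := fun r hr =>
    le_antisymm ((S.antitoneOn_snd hC0 hs (hs.trans (hsu.trans hr)) (hsu.trans hr)).trans hz)
      (hcon r (hsu.trans hr))
  have h1 := (S.deriv_snd u hu).mono (Ici_subset_Ici.2 hu)
  have h2 : HasDerivWithinAt z 0 (Ici u) u :=
    (hasDerivWithinAt_const u (Ici u) (0 : ℝ)).congr hconst (hconst u self_mem_Ici)
  have h3 := (uniqueDiffOn_Ici u u self_mem_Ici).eq_deriv _ h1 h2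
  exact neg_ne_zero.2 (mul_ne_zero hCu (S.pos u hu).ne') h3

/-- The solutions of the linear system in terms of one of them (d'Alembert reduction). -/
theorem reduction (S : LinSol A C T φ z) (hA : ContinuousOn A (Ici T)) {κ : ℝ}
    (hκ : ∀ t, T ≤ t → 0 < 1 + κ * quad A φ T t) :
    LinSol A C T (fun t => φ t * (1 + κ * quad A φ T t))
      (fun t => κ / φ t + (1 + κ * quad A φ T t) * z t) where
  pos t ht := mul_pos (S.pos t ht) (hκ t ht)
  deriv_fst t ht := by
    have hne := (S.pos t ht).ne'
    refine ((S.deriv_fst t ht).mul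
      (((S.hasDerivWithinAt_quad hA ht).const_mul κ).const_add 1)).congr_deriv ?_
    field_simp
    ring
  deriv_snd t ht := by
    have hne := (S.pos t ht).ne'
    refine ((((S.deriv_fst t ht).inv hne).const_mul κ).add
      ((((S.hasDerivWithinAt_quad hA ht).const_mul κ).const_add 1).mul
        (S.deriv_snd t ht))).congr_deriv ?_
    field_simp
    ring

/-- Every solution starting with the same first component arises from the reduction. -/
theorem eq_reduction (S : LinSol A C T φ z) (hA : ContinuousOn A (Ici T))
    (R : LinSol A C T ψ ζ) (h1 : φ T = 1) (h2 : ψ T = 1) {t : ℝ} (ht : T ≤ t) :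
    ψ t = φ t * (1 + (ζ T - z T) * quad A φ T t) ∧
      ζ t = (ζ T - z T) / φ t + (1 + (ζ T - z T) * quad A φ T t) * z t := by
  -- The Wronskian is constant, so `ψ / φ` has derivative `(ζ T - z T) A / φ²`.
  have hW : ∀ t, T ≤ t → φ t * ζ t - ψ t * z t = ζ T - z T := by
    intro t ht
    refine eq_of_deriv_eq (T := T) (f := fun t => φ t * ζ t - ψ t * z t)
      (g := fun _ => ζ T - z T)
      (fun t ht => ((S.deriv_fst t ht).mul (R.deriv_snd t ht)).sub
        ((R.deriv_fst t ht).mul (S.deriv_snd t ht)))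
      (fun t _ => hasDerivWithinAt_const t _ _) (fun t _ => by ring) ?_ ht
    simp [h1, h2]
  have hne := (S.pos t ht).ne'
  have hr : ψ t / φ t = 1 + (ζ T - z T) * quad A φ T t := by
    refine eq_of_deriv_eq (T := T) (f := fun t => ψ t / φ t)
      (fun t ht => (R.deriv_fst t ht).div (S.deriv_fst t ht) (S.pos t ht).ne')
      (fun t ht => ((S.hasDerivWithinAt_quad hA ht).const_mul (ζ T - z T)).const_add 1)
      (fun t ht => ?_) ?_ ht
    · rw [← hW t ht]
      ring
    · simp [h1, h2, quad]
  have hψ : ψ t = φ t * (1 + (ζ T - z T) * quad A φ T t) := by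
    rw [← hr]; field_simp
  refine ⟨hψ, ?_⟩
  have := hW t ht
  rw [hψ] at this
  field_simp
  linarith

theorem fst_le (S : LinSol A C T φ z) (hA : ContinuousOn A (Ici T))
    (hA0 : ∀ t, T ≤ t → 0 ≤ A t) (hC0 : ∀ t, T ≤ t → 0 ≤ C t) {K : ℝ} (hK : z T ≤ K) {t : ℝ}
    (ht : T ≤ t) : φ t ≤ φ T + K * ∫ s in T..t, A s := by
  refine le_of_deriv_le (T := T) S.deriv_fst
    (fun t ht => ((hasDerivWithinAt_integral hA ht).const_mul K).const_add (φ T))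
    (fun t ht => ?_) (by simp) ht
  have := S.antitoneOn_snd hC0 self_mem_Ici (mem_Ici.2 ht) ht
  nlinarith [hA0 t ht]

theorem snd_le (S : LinSol A C T φ z) (hC : ContinuousOn C (Ici T))
    (hC0 : ∀ t, T ≤ t → 0 ≤ C t) {L : ℝ} (hL : ∀ t, T ≤ t → L ≤ φ t) {t : ℝ}
    (ht : T ≤ t) : z t ≤ z T - L * ∫ s in T..t, C s := by
  refine le_of_deriv_le (T := T) S.deriv_snd
    (fun t ht => ((hasDerivWithinAt_integral hC ht).const_mul L).const_sub (z T))
    (fun t ht => ?_) (by simp) ht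
  nlinarith [hC0 t ht, hL t ht]

theorem le_snd (S : LinSol A C T φ z) (hC : ContinuousOn C (Ici T))
    (hC0 : ∀ t, T ≤ t → 0 ≤ C t) {B : ℝ} (hB : ∀ t, T ≤ t → φ t ≤ B) {t : ℝ}
    (ht : T ≤ t) : z T - B * ∫ s in T..t, C s ≤ z t := by
  refine le_of_deriv_le (T := T)
    (fun t ht => ((hasDerivWithinAt_integral hC ht).const_mul B).const_sub (z T)) S.deriv_snd
    (fun t ht => ?_) (by simp) ht
  nlinarith [hC0 t ht, hB t ht]

theorem quad_le (S : LinSol A C T φ z) (hA : ContinuousOn A (Ici T))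
    (hA0 : ∀ t, T ≤ t → 0 ≤ A t) {L : ℝ} (hL : 0 < L) (hφ : ∀ t, T ≤ t → L ≤ φ t) {t : ℝ}
    (ht : T ≤ t) : quad A φ T t ≤ (∫ s in T..t, A s) / L ^ 2 := by
  refine le_of_deriv_le (T := T) (fun t ht => S.hasDerivWithinAt_quad hA ht)
    (fun t ht => (hasDerivWithinAt_integral hA ht).div_const (L ^ 2))
    (fun t ht => ?_) (by simp [quad]) ht
  have := hφ t ht
  have := hA0 t ht
  gcongr

theorem le_quad (S : LinSol A C T φ z) (hA : ContinuousOn A (Ici T))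
    (hA0 : ∀ t, T ≤ t → 0 ≤ A t) {M : ℝ} (hφ : ∀ t, T ≤ t → φ t ≤ M) {t : ℝ}
    (ht : T ≤ t) : (∫ s in T..t, A s) / M ^ 2 ≤ quad A φ T t := by
  refine le_of_deriv_le (T := T)
    (fun t ht => (hasDerivWithinAt_integral hA ht).div_const (M ^ 2))
    (fun t ht => S.hasDerivWithinAt_quad hA ht) (fun t ht => ?_) (by simp [quad]) ht
  have := hφ t ht
  have := hA0 t ht
  have := S.pos t ht
  gcongr

/-- If `z` takes a negative value then `∫ A` is bounded. -/
theorem exists_integral_le (S : LinSol A C T φ z) (hA : ContinuousOn A (Ici T))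
    (hA0 : ∀ t, T ≤ t → 0 ≤ A t) (hC0 : ∀ t, T ≤ t → 0 ≤ C t) {s : ℝ} (hs : T ≤ s)
    (hz : z s < 0) : ∃ M, 0 < M ∧ ∀ t, T ≤ t → ∫ s in T..t, A s ≤ M := by
  have hI0 : 0 ≤ ∫ r in T..s, A r := integral_nonneg_Ici hA0 hs
  have key : ∀ t, s ≤ t → ∫ r in T..t, A r ≤ (∫ r in T..s, A r) + φ s / (-z s) := by
    intro t ht
    have h1 := (S.mono hs).fst_le (hA.mono (Ici_subset_Ici.2 hs))
      (fun t ht => hA0 t (hs.trans ht)) (fun t ht => hC0 t (hs.trans ht)) le_rfl ht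
    have h2 := (S.mono hs).pos t ht
    have h3 : ∫ r in s..t, A r ≤ φ s / (-z s) := by
      rw [le_div_iff₀ (by linarith)]
      linarith
    have := intervalIntegral.integral_add_adjacent_intervals
      (intervalIntegrable_of_Ici hA le_rfl hs) (intervalIntegrable_of_Ici hA hs (hs.trans ht))
    linarith
  have hpos : 0 < φ s / (-z s) := div_pos (S.pos s hs) (by linarith)
  refine ⟨(∫ r in T..s, A r) + φ s / (-z s), by linarith, fun t ht => ?_⟩
  rcases le_total s t with h | h
  · exact key t h
  · exact (monotoneOn_integral hA hA0 ht hs h).trans (by linarith)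

/-- A nonpositive value of `z` would turn negative because `C` does not die out, and that bounds `∫
A`. -/
theorem snd_pos (S : LinSol A C T φ z) (hA : ContinuousOn A (Ici T))
    (hA0 : ∀ t, T ≤ t → 0 ≤ A t) (hC0 : ∀ t, T ≤ t → 0 ≤ C t) (hsupp : UnboundedSupport C T)
    (hI : IntegralEqTop A T) {t : ℝ} (ht : T ≤ t) : 0 < z t := by
  by_contra! hz
  obtain ⟨s, hs, hzs⟩ := S.exists_neg hC0 hsupp ht hz
  obtain ⟨M, -, hM⟩ := S.exists_integral_le hA hA0 hC0 (ht.trans hs) hzs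
  obtain ⟨u, hu, hTu⟩ := ((hI.eventually_gt_atTop M).and (eventually_ge_atTop T)).exists
  exact (hM u hTu).not_gt hu

/-- If the nondecreasing `φ` stayed below `M`, then `quad ≥ ∫ A / M²` would be unbounded. -/
theorem tendsto_fst_atTop_of_quad_le (S : LinSol A C T φ z) (hA : ContinuousOn A (Ici T))
    (hA0 : ∀ t, T ≤ t → 0 ≤ A t) (hz : ∀ t, T ≤ t → 0 < z t) (hI : IntegralEqTop A T) {B : ℝ}
    (hB : ∀ t, T ≤ t → quad A φ T t ≤ B) : Tendsto φ atTop atTop := by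
  refine tendsto_atTop_of_monotoneOn_Ici (S.monotoneOn_fst hA0 fun t ht => (hz t ht).le) ?_
  by_contra! hcon
  obtain ⟨M, hM⟩ := hcon
  have hM0 : 0 < M := (S.pos T le_rfl).trans (hM T le_rfl)
  obtain ⟨u, hu, hTu⟩ := ((hI.eventually_gt_atTop (B * M ^ 2)).and (eventually_ge_atTop T)).exists
  have h1 := (S.le_quad hA hA0 (fun t ht => (hM t ht).le) hTu).trans (hB u hTu)
  rw [div_le_iff₀ (by positivity)] at h1
  linarith

/-- The function `φ - z ∫ A` has derivative `C φ ∫ A ≥ C ∫ A`, since `φ ≥ 1`, and `φ` dominates it.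
-/
theorem tendsto_fst_atTop_of_integral (S : LinSol A C T φ z) (hA : ContinuousOn A (Ici T))
    (hC : ContinuousOn C (Ici T))
    (hA0 : ∀ t, T ≤ t → 0 ≤ A t) (hC0 : ∀ t, T ≤ t → 0 ≤ C t) (hz : ∀ t, T ≤ t → 0 < z t)
    (h1 : φ T = 1) (hI : IntegralEqTop (fun t => C t * ∫ s in T..t, A s) T) :
    Tendsto φ atTop atTop := by
  have hIA : ∀ t, T ≤ t → 0 ≤ ∫ s in T..t, A s := fun t ht => integral_nonneg_Ici hA0 ht
  have hcont : ContinuousOn (fun t => C t * ∫ s in T..t, A s) (Ici T) :=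
    hC.mul fun t ht => (hasDerivWithinAt_integral hA ht).continuousWithinAt
  refine tendsto_atTop_mono' _ ?_ hI
  filter_upwards [eventually_ge_atTop T] with t ht
  have h := le_of_deriv_le (T := T) (fun t ht => hasDerivWithinAt_integral hcont ht)
    (fun t ht => (S.deriv_fst t ht).sub ((S.deriv_snd t ht).mul (hasDerivWithinAt_integral hA ht)))
    (fun t ht => ?_) (by simp [h1]) ht
  · have := mul_nonneg (hz t ht).le (hIA t ht)
    simp only [Pi.sub_apply, Pi.mul_apply] at h
    linarith
  · have h3 := S.monotoneOn_fst hA0 (fun t ht => (hz t ht).le) self_mem_Ici (mem_Ici.2 ht) ht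
    have h4 := mul_nonneg (mul_nonneg (hC0 t ht) (hIA t ht)) (sub_nonneg.2 h3)
    rw [h1] at h4
    linarith

/-- While `z ≥ 0`, `φ` is at least `φ T`, so `z` decreases at least as fast as `φ T ∫ C` grows. -/
theorem exists_snd_neg_of_integral (S : LinSol A C T φ z) (hC : ContinuousOn C (Ici T))
    (hA0 : ∀ t, T ≤ t → 0 ≤ A t) (hC0 : ∀ t, T ≤ t → 0 ≤ C t)
    (hI : IntegralEqTop C T) : ∃ s, T ≤ s ∧ z s < 0 := by
  by_contra! hcon
  have hm := S.monotoneOn_fst hA0 hcon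
  obtain ⟨u, hu, hTu⟩ :=
    ((hI.eventually_gt_atTop (z T / φ T)).and (eventually_ge_atTop T)).exists
  have h1 := S.snd_le hC hC0 (fun t ht => hm self_mem_Ici (mem_Ici.2 ht) ht) hTu
  rw [div_lt_iff₀ (S.pos T le_rfl)] at hu
  linarith [hcon u hTu]

theorem exists_snd_neg_of_quad (S : LinSol A C T φ z) (hA : ContinuousOn A (Ici T))
    (hA0 : ∀ t, T ≤ t → 0 ≤ A t) {M : ℝ} (hM : ∀ t, T ≤ t → ∫ s in T..t, A s ≤ M)
    (hq : ∀ B, ∃ t, T ≤ t ∧ B < quad A φ T t) : ∃ s, T ≤ s ∧ z s < 0 := by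
  by_contra! hcon
  have hm := S.monotoneOn_fst hA0 hcon
  obtain ⟨t, ht, hlt⟩ := hq (M / φ T ^ 2)
  have h1 := S.quad_le hA hA0 (S.pos T le_rfl)
    (fun t ht => hm self_mem_Ici (mem_Ici.2 ht) ht) ht
  have h2 : (∫ s in T..t, A s) / φ T ^ 2 ≤ M / φ T ^ 2 := by
    gcongr
    exact hM t ht
  linarith

/-- If `z` becomes negative then `φ` tends to zero unless it is bounded away from zero. -/
theorem tendsto_fst_zero (S : LinSol A C T φ z) (hA0 : ∀ t, T ≤ t → 0 ≤ A t)
    (hC0 : ∀ t, T ≤ t → 0 ≤ C t) {s : ℝ} (hs : T ≤ s) (hz : z s < 0)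
    (h : ∀ L, 0 < L → ∃ t, T ≤ t ∧ φ t < L) : Tendsto φ atTop (𝓝 0) := by
  have hzs : ∀ t, s ≤ t → z t ≤ 0 := fun t ht =>
    (S.antitoneOn_snd hC0 hs (hs.trans ht) ht).trans hz.le
  have hanti := (S.mono hs).antitoneOn_fst (fun t ht => hA0 t (hs.trans ht)) hzs
  obtain ⟨p, hp, hmin⟩ := isCompact_Icc.exists_isMinOn (nonempty_Icc.2 hs)
    (S.continuousOn_fst.mono (Icc_subset_Ici_self : Icc T s ⊆ Ici T))
  refine tendsto_order.2 ⟨fun m hm => ?_, fun m hm => ?_⟩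
  · filter_upwards [eventually_ge_atTop T] with t ht
    exact hm.trans (S.pos t ht)
  -- A value below the minimum `φ p` over `[T, s]` can only occur after `s`, where `φ` is already
  -- nonincreasing.
  · obtain ⟨t, ht, hlt⟩ := h (min m (φ p)) (lt_min hm (S.pos p hp.1))
    have hst : s ≤ t := by
      by_contra! hts
      exact ((hmin ⟨ht, hts.le⟩).trans_lt (hlt.trans_le (min_le_right _ _))).false
    filter_upwards [eventually_ge_atTop t] with u hu
    exact (hanti hst (hst.trans hu) hu).trans_lt (hlt.trans_le (min_le_left _ _))

theorem tendsto_fst_zero_of_quad (S : LinSol A C T φ z) (hA : ContinuousOn A (Ici T))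
    (hA0 : ∀ t, T ≤ t → 0 ≤ A t) (hC0 : ∀ t, T ≤ t → 0 ≤ C t) {s : ℝ} (hs : T ≤ s)
    (hz : z s < 0) (hq : ∀ B, ∃ t, T ≤ t ∧ B < quad A φ T t) : Tendsto φ atTop (𝓝 0) := by
  obtain ⟨M, -, hM⟩ := S.exists_integral_le hA hA0 hC0 hs hz
  refine S.tendsto_fst_zero hA0 hC0 hs hz ?_
  by_contra! hcon
  obtain ⟨L, hL, hφ⟩ := hcon
  obtain ⟨t, ht, hlt⟩ := hq (M / L ^ 2)
  have h1 := S.quad_le hA hA0 hL hφ ht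
  have h2 : (∫ s in T..t, A s) / L ^ 2 ≤ M / L ^ 2 := by
    gcongr
    exact hM t ht
  linarith

/-- If `φ ≥ L > 0`, then `z ≤ z T - L ∫ C`; integrating `φ' = A z` with `∫ A` bounded drives `φ`
below zero. -/
theorem tendsto_fst_zero_of_integral (S : LinSol A C T φ z) (hA : ContinuousOn A (Ici T))
    (hC : ContinuousOn C (Ici T))
    (hA0 : ∀ t, T ≤ t → 0 ≤ A t) (hC0 : ∀ t, T ≤ t → 0 ≤ C t) {s : ℝ} (hs : T ≤ s)
    (hz : z s < 0) (hI : IntegralEqTop (fun t => A t * ∫ s in T..t, C s) T) :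
    Tendsto φ atTop (𝓝 0) := by
  obtain ⟨M, -, hM⟩ := S.exists_integral_le hA hA0 hC0 hs hz
  refine S.tendsto_fst_zero hA0 hC0 hs hz ?_
  by_contra! hcon
  obtain ⟨L, hL, hφ⟩ := hcon
  have hcont : ContinuousOn (fun t => A t * ∫ s in T..t, C s) (Ici T) :=
    hA.mul fun t ht => (hasDerivWithinAt_integral hC ht).continuousWithinAt
  obtain ⟨u, hu, hTu⟩ := ((hI.eventually_gt_atTop ((φ T + |z T| * M) / L)).and
    (eventually_ge_atTop T)).exists
  have h := le_of_deriv_le (T := T) S.deriv_fst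
    (fun t ht => (((hasDerivWithinAt_integral hA ht).const_mul |z T|).const_add (φ T)).sub
      ((hasDerivWithinAt_integral hcont ht).const_mul L)) (fun t ht => ?_) (by simp) hTu
  · rw [div_lt_iff₀ hL] at hu
    have h1 := mul_le_mul_of_nonneg_left (hM u hTu) (abs_nonneg (z T))
    have h2 := S.pos u hTu
    simp only [Pi.sub_apply] at h
    linarith
  · have h1 := S.snd_le hC hC0 hφ ht
    have h2 := mul_le_mul_of_nonneg_left (h1.trans (sub_le_sub_right (le_abs_self (z T)) _))
      (hA0 t ht)
    linarith

/-- Bounded `∫ A` bounds `φ` above, whence bounded `∫ C` gives `z ≥ -K`. Then `(1/φ)' = -z A / φ² ≤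
K A / φ²`, so bounded `quad` keeps `φ` away from zero. Finally `φ` is eventually monotone because
`z` changes sign at most once. -/
theorem exists_tendsto_fst_pos (S : LinSol A C T φ z) (hA : ContinuousOn A (Ici T))
    (hC : ContinuousOn C (Ici T))
    (hA0 : ∀ t, T ≤ t → 0 ≤ A t) (hC0 : ∀ t, T ≤ t → 0 ≤ C t) {M N B : ℝ}
    (hM : ∀ t, T ≤ t → ∫ s in T..t, A s ≤ M) (hN : ∀ t, T ≤ t → ∫ s in T..t, C s ≤ N)
    (hB : ∀ t, T ≤ t → quad A φ T t ≤ B) : ∃ l, 0 < l ∧ Tendsto φ atTop (𝓝 l) := by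
  set D := φ T + |z T| * M
  have hφD : ∀ t, T ≤ t → φ t ≤ D := fun t ht =>
    (S.fst_le hA hA0 hC0 (le_abs_self _) ht).trans
      (add_le_add_right (mul_le_mul_of_nonneg_left (hM t ht) (abs_nonneg _)) _)
  have hD : 0 < D := (S.pos T le_rfl).trans_le (hφD T le_rfl)
  have hN0 : 0 ≤ N := by simpa using hN T le_rfl
  have hB0 : 0 ≤ B := by simpa [quad] using hB T le_rfl
  set K := |z T| + D * N
  have hK0 : 0 ≤ K := by positivity
  have hzK : ∀ t, T ≤ t → -K ≤ z t := fun t ht => by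
    have h1 := S.le_snd hC hC0 hφD ht
    have h2 := mul_le_mul_of_nonneg_left (hN t ht) hD.le
    have h3 := neg_abs_le (z T)
    simp only [K]
    linarith
  set Q := (φ T)⁻¹ + K * B
  have hQ : 0 < Q := by
    have := S.pos T le_rfl
    positivity
  have hinv : ∀ t, T ≤ t → (φ t)⁻¹ ≤ Q := by
    intro t ht
    have h := le_of_deriv_le (T := T)
      (fun t ht => (S.deriv_fst t ht).inv (S.pos t ht).ne')
      (fun t ht => ((S.hasDerivWithinAt_quad hA ht).const_mul K).const_add (φ T)⁻¹)
      (fun t ht => ?_) (by simp [quad]) ht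
    · refine h.trans ?_
      simp only [Q]
      gcongr
      exact hB t ht
    · have h1 := S.div_nonneg hA0 t ht
      have h2 : -(A t * z t) / φ t ^ 2 = A t / φ t ^ 2 * (-z t) := by ring
      rw [h2, mul_comm K]
      exact mul_le_mul_of_nonneg_left (by linarith [hzK t ht]) h1
  have hlow : ∀ t, T ≤ t → Q⁻¹ ≤ φ t := fun t ht =>
    inv_le_of_inv_le₀ (S.pos t ht) (hinv t ht)
  have hlim : ∃ l, Tendsto φ atTop (𝓝 l) := by
    by_cases hz : ∀ t, T ≤ t → 0 ≤ z t
    · exact exists_tendsto_of_monotoneOn_Ici (S.monotoneOn_fst hA0 hz) hφD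
    · push Not at hz
      obtain ⟨s, hs, hzs⟩ := hz
      exact exists_tendsto_of_antitoneOn_Ici ((S.mono hs).antitoneOn_fst
        (fun t ht => hA0 t (hs.trans ht)) fun t ht =>
          (S.antitoneOn_snd hC0 hs (hs.trans ht) ht).trans hzs.le)
        fun t ht => hlow t (hs.trans ht)
  obtain ⟨l, hl⟩ := hlim
  refine ⟨l, (inv_pos.2 hQ).trans_le (ge_of_tendsto hl ?_), hl⟩
  filter_upwards [eventually_ge_atTop T] with t ht using hlow t ht

/-- If `∫ A` and `∫ C` are small compared with each other, a large initial value of `z` keeps `z`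
nonnegative. -/
theorem snd_nonneg_of_large (S : LinSol A C T φ z) (hA : ContinuousOn A (Ici T))
    (hC : ContinuousOn C (Ici T))
    (hA0 : ∀ t, T ≤ t → 0 ≤ A t) (hC0 : ∀ t, T ≤ t → 0 ≤ C t) {M N : ℝ}
    (hM : ∀ t, T ≤ t → ∫ s in T..t, A s ≤ M) (hN : ∀ t, T ≤ t → ∫ s in T..t, C s ≤ N)
    (hz0 : 0 ≤ z T) (hz : (φ T + z T * M) * N ≤ z T) {t : ℝ} (ht : T ≤ t) : 0 ≤ z t := by
  have hφD : ∀ t, T ≤ t → φ t ≤ φ T + z T * M := fun t ht =>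
    (S.fst_le hA hA0 hC0 le_rfl ht).trans (by gcongr; exact hM t ht)
  have hD : 0 < φ T + z T * M := (S.pos T le_rfl).trans_le (hφD T le_rfl)
  have h1 := S.le_snd hC hC0 hφD ht
  have h2 := mul_le_mul_of_nonneg_left (hN t ht) hD.le
  linarith

end LinSol

end Linear

/-! ### Passage between the Riccati equation and the linear system. -/

section Weight

variable {a b c x y : ℝ → ℝ} {t₀ T : ℝ}

theorem J_pos (u : ℝ → ℝ) (s t : ℝ) : 0 < J u s t := Real.exp_pos _

@[simp] theorem J_self (u : ℝ → ℝ) (s : ℝ) : J u s s = 1 := by simp [J]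

theorem hasDerivWithinAt_J (hb : ContinuousOn b (Ici t₀)) {t : ℝ} (ht : t₀ ≤ t) :
    HasDerivWithinAt (J b t₀) (b t * J b t₀ t) (Ici t₀) t :=
  (hasDerivWithinAt_integral hb ht).exp.congr_deriv (mul_comm _ _)

theorem continuousOn_J (hb : ContinuousOn b (Ici t₀)) : ContinuousOn (J b t₀) (Ici t₀) :=
  fun _ ht => (hasDerivWithinAt_J hb ht).continuousWithinAt

theorem J_neg (u : ℝ → ℝ) (s t : ℝ) : J (fun r => -u r) s t = (J u s t)⁻¹ := by
  simp [J, intervalIntegral.integral_neg, Real.exp_neg]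

theorem J_eq_div (hb : ContinuousOn b (Ici t₀)) {s t : ℝ} (hs : t₀ ≤ s) (ht : t₀ ≤ t) :
    J b s t = J b t₀ t / J b t₀ s := by
  rw [J, J, J, ← Real.exp_sub, intervalIntegral.integral_interval_sub_left
    (intervalIntegrable_of_Ici hb le_rfl ht) (intervalIntegrable_of_Ici hb le_rfl hs)]

theorem IPlusIntegrand_eq_div (u v : ℝ → ℝ) (s t : ℝ) :
    IPlusIntegrand u v s t = u t / J v s t := by
  rw [IPlusIntegrand, J_neg, div_eq_mul_inv]

theorem IPlusIntegrand_neg (u v : ℝ → ℝ) (s t : ℝ) :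
    IPlusIntegrand u (fun r => -v r) s t = u t * J v s t := by
  simp [IPlusIntegrand]

theorem continuousOn_IPlusIntegrand (ha : ContinuousOn a (Ici t₀))
    (hb : ContinuousOn b (Ici t₀)) : ContinuousOn (IPlusIntegrand a b t₀) (Ici t₀) :=
  ha.mul (continuousOn_J hb.neg)

theorem IPlusIntegrand_nonneg (ha : ∀ t, t₀ ≤ t → 0 ≤ a t) {t : ℝ} (ht : t₀ ≤ t) :
    0 ≤ IPlusIntegrand a b t₀ t :=
  mul_nonneg (ha t ht) (J_pos _ _ _).le

theorem UnboundedSupport.IPlusIntegrand (ha : UnboundedSupport a t₀) :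
    UnboundedSupport (IPlusIntegrand a b t₀) t₀ := fun T => by
  obtain ⟨t, h1, h2, h3⟩ := ha T
  exact ⟨t, h1, h2, mul_ne_zero h3 (J_pos _ _ _).ne'⟩

theorem UnboundedSupport.mono (ha : UnboundedSupport a t₀) (T : ℝ) :
    UnboundedSupport a T := fun s => by
  obtain ⟨t, h1, h2, h3⟩ := ha (max s T)
  exact ⟨t, (le_max_right _ _).trans h2, (le_max_left _ _).trans h2, h3⟩

/-- The cocycle identity for `J` pulls the factor in `t` out of the integral; this turns the
additional hypotheses of the first two cases into divergence of `∫ C ∫ A` and `∫ A ∫ C`. -/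
theorem IMinus_eq (hb : ContinuousOn b (Ici t₀)) {t : ℝ} (ht : t₀ ≤ t) :
    IMinus b c t₀ t = (∫ s in t₀..t, IPlusIntegrand c (fun r => -b r) t₀ s) / J b t₀ t := by
  rw [IMinus, ← intervalIntegral.integral_div]
  refine intervalIntegral.integral_congr fun s hs => ?_
  rw [uIcc_of_le ht] at hs
  rw [IPlusIntegrand_neg, J_neg, J_eq_div hb hs.1 ht]
  have := (J_pos b t₀ s).ne'
  have := (J_pos b t₀ t).ne'
  field_simp

theorem IntegralEqTop.congr {f g : ℝ → ℝ} (h : IntegralEqTop f T)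
    (hfg : ∀ t, T ≤ t → f t = g t) : IntegralEqTop g T := by
  refine Tendsto.congr' ?_ h
  filter_upwards [eventually_ge_atTop T] with t ht
  refine intervalIntegral.integral_congr fun s hs => ?_
  rw [uIcc_of_le ht] at hs
  exact hfg s hs.1

/-- `exp (∫_T^t a x)`, the first component of the linear system attached to the solution `x`. -/
noncomputable def fundSol (a x : ℝ → ℝ) (T t : ℝ) : ℝ := Real.exp (∫ s in T..t, a s * x s)

/-- The second component of the linear system attached to the solution `x`. -/
noncomputable def coSol (a b x : ℝ → ℝ) (t₀ T t : ℝ) : ℝ := x t * (fundSol a x T t * J b t₀ t)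

theorem fundSol_pos (a x : ℝ → ℝ) (T t : ℝ) : 0 < fundSol a x T t := Real.exp_pos _

@[simp] theorem fundSol_self (a x : ℝ → ℝ) (T : ℝ) : fundSol a x T T = 1 := by simp [fundSol]

@[simp] theorem coSol_self (a b x : ℝ → ℝ) (t₀ T : ℝ) :
    coSol a b x t₀ T T = x T * J b t₀ T := by simp [coSol]

theorem factor_pos (a b x : ℝ → ℝ) (t₀ T t : ℝ) : 0 < fundSol a x T t * J b t₀ t :=
  mul_pos (fundSol_pos _ _ _ _) (J_pos _ _ _)

theorem coSol_pos_iff {t : ℝ} : 0 < coSol a b x t₀ T t ↔ 0 < x t :=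
  mul_pos_iff_of_pos_right (factor_pos _ _ _ _ _ _)

theorem coSol_neg_iff {t : ℝ} : coSol a b x t₀ T t < 0 ↔ x t < 0 := by
  rw [coSol, mul_neg_iff]
  have := factor_pos a b x t₀ T t
  constructor
  · rintro (h | h)
    · linarith [h.2]
    · exact h.1
  · exact fun h => Or.inr ⟨h, this⟩

theorem IsRegular.continuousOn (h : IsRegular a b c T x) : ContinuousOn x (Ici T) :=
  fun t ht => (h t ht).continuousWithinAt

theorem IsRegular.mono (h : IsRegular a b c t₀ x) (hT : t₀ ≤ T) : IsRegular a b c T x :=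
  fun t ht => (h t (hT.trans ht)).mono (Ici_subset_Ici.2 hT)

/-- A regular solution of the Riccati equation yields a solution of the linear system. -/
theorem IsRegular.linSol (h : IsRegular a b c T x) (ha : ContinuousOn a (Ici t₀))
    (hb : ContinuousOn b (Ici t₀)) (hT : t₀ ≤ T) :
    LinSol (IPlusIntegrand a b t₀) (IPlusIntegrand c (fun s => -b s) t₀) T
      (fundSol a x T) (coSol a b x t₀ T) := by
  have hφ : ∀ t, T ≤ t → HasDerivWithinAt (fundSol a x T) (fundSol a x T t * (a t * x t))
      (Ici T) t := fun t ht =>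
    (hasDerivWithinAt_integral ((ha.mono (Ici_subset_Ici.2 hT)).mul h.continuousOn) ht).exp
  refine ⟨fun t _ => fundSol_pos _ _ _ _, fun t ht => (hφ t ht).congr_deriv ?_, fun t ht =>
    ((h t ht).mul ((hφ t ht).mul ((hasDerivWithinAt_J hb (hT.trans ht)).mono
      (Ici_subset_Ici.2 hT)))).congr_deriv ?_⟩
  · rw [IPlusIntegrand_eq_div, coSol]
    have := (J_pos b t₀ t).ne'
    field_simp
  · simp only [IPlusIntegrand_neg, Pi.mul_apply]
    ring

/-- A solution of the linear system with positive first component yields a regular solution of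
the Riccati equation. -/
theorem LinSol.isRegular {φ z : ℝ → ℝ}
    (S : LinSol (IPlusIntegrand a b t₀) (IPlusIntegrand c (fun s => -b s) t₀) T φ z)
    (hb : ContinuousOn b (Ici t₀)) (hT : t₀ ≤ T) :
    IsRegular a b c T (fun t => z t / (φ t * J b t₀ t)) := fun t ht => by
  have h1 := (J_pos b t₀ t).ne'
  have h2 := (S.pos t ht).ne'
  refine ((S.deriv_snd t ht).div ((S.deriv_fst t ht).mul ((hasDerivWithinAt_J hb
    (hT.trans ht)).mono (Ici_subset_Ici.2 hT))) (mul_ne_zero h2 h1)).congr_deriv ?_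
  rw [IPlusIntegrand_neg, IPlusIntegrand_eq_div, Pi.mul_apply]
  field_simp
  ring

/-- The derivative of `x J_b` is `-(a x² + c) J_b`. A general interval is allowed so that non-global
solutions are covered. -/
theorem IsSolutionOn.antitoneOn {s : Set ℝ} (h : IsSolutionOn a b c x s) (hs : Convex ℝ s)
    (hst : s ⊆ Ici t₀) (hb : ContinuousOn b (Ici t₀)) (ha0 : ∀ t, t₀ ≤ t → 0 ≤ a t)
    (hc0 : ∀ t, t₀ ≤ t → 0 ≤ c t) : AntitoneOn (fun t => x t * J b t₀ t) s := by
  have hd : ∀ t ∈ s, HasDerivWithinAt (fun t => x t * J b t₀ t)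
      (-(a t * x t ^ 2 + c t) * J b t₀ t) s t := fun t ht =>
    ((h t ht).mul ((hasDerivWithinAt_J hb (hst ht)).mono hst)).congr_deriv (by ring)
  refine antitoneOn_of_hasDerivWithinAt_nonpos hs (fun t ht => (hd t ht).continuousWithinAt)
    (fun t ht => (hd t (interior_subset ht)).mono interior_subset) fun t ht => ?_
  have ht' := hst (interior_subset ht)
  have h1 := mul_nonneg (ha0 t ht') (sq_nonneg (x t))
  exact mul_nonpos_of_nonpos_of_nonneg (by linarith [hc0 t ht']) (J_pos _ _ _).le

theorem IsSolutionOn.neg_of_neg {s : Set ℝ} (h : IsSolutionOn a b c x s) (hs : Convex ℝ s)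
    (hst : s ⊆ Ici t₀) (hb : ContinuousOn b (Ici t₀)) (ha0 : ∀ t, t₀ ≤ t → 0 ≤ a t)
    (hc0 : ∀ t, t₀ ≤ t → 0 ≤ c t) {p t : ℝ} (hp : p ∈ s) (ht : t ∈ s) (hpt : p ≤ t)
    (hx : x p < 0) : x t < 0 := by
  have h1 := h.antitoneOn hs hst hb ha0 hc0 hp ht hpt
  have h2 := mul_neg_of_neg_of_pos hx (J_pos b t₀ p)
  by_contra! h3
  have h4 := mul_nonneg h3 (J_pos b t₀ t).le
  simp only at h1
  linarith

theorem IsRegular.sign_pattern (h : IsRegular a b c T x) (hT : t₀ ≤ T)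
    (hb : ContinuousOn b (Ici t₀)) (ha0 : ∀ t, t₀ ≤ t → 0 ≤ a t) (hc0 : ∀ t, t₀ ≤ t → 0 ≤ c t)
    (hx : 0 ≤ x T) {s : ℝ} (hs : T ≤ s) (hneg : x s < 0) :
    ∃ p q, T ≤ p ∧ (0 < x T → T < p) ∧ (x T = 0 → p = T) ∧ p ≤ q ∧ (∀ t ∈ Ico T p, 0 < x t) ∧
      (∀ t ∈ Icc p q, x t = 0) ∧ ∀ t, q < t → x t < 0 := by
  have hJ := J_pos b t₀
  obtain ⟨p, q, h1, h2, h3, h4, h5, h6, h7⟩ := exists_sign_pattern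
    (h.antitoneOn (convex_Ici T) (Ici_subset_Ici.2 hT) hb ha0 hc0)
    (h.continuousOn.mul ((continuousOn_J hb).mono (Ici_subset_Ici.2 hT)))
    (mul_nonneg hx (hJ T).le) hs (mul_neg_of_neg_of_pos hneg (hJ s))
  refine ⟨p, q, h1, fun h => h2 (mul_pos h (hJ T)), fun h => h3 (by simp [h]), h4,
    fun t ht => (mul_pos_iff_of_pos_right (hJ t)).1 (h5 t ht),
    fun t ht => (mul_eq_zero.1 (h6 t ht)).resolve_right (hJ t).ne', fun t ht => ?_⟩
  by_contra! hx
  exact (mul_nonneg hx (hJ t).le).not_gt (h7 t ht)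

theorem integralEqTop_of_fundSol (h : Tendsto (fundSol a x T) atTop atTop) :
    IntegralEqTop (fun t => a t * x t) T :=
  Real.tendsto_exp_comp_atTop.1 h

theorem integralEqBot_of_fundSol (h : Tendsto (fundSol a x T) atTop (𝓝 0)) :
    IntegralEqBot (fun t => a t * x t) T :=
  Real.tendsto_exp_comp_nhds_zero.1 h

theorem integralConverges_of_fundSol {l : ℝ} (hl : 0 < l)
    (h : Tendsto (fundSol a x T) atTop (𝓝 l)) : IntegralConverges (fun t => a t * x t) T :=
  ⟨Real.log l, (h.log hl.ne').congr fun t => by simp [fundSol]⟩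

end Weight

/-! ### Regular initial values, the extremal solution and the threshold solution. -/

section Regular

variable {a b c x y : ℝ → ℝ} {t₀ T : ℝ}

/-- The solution with initial value `x T + κ / J b t₀ T`. -/
theorem IsRegular.exists_reduction (h : IsRegular a b c T x) (ha : ContinuousOn a (Ici t₀))
    (hb : ContinuousOn b (Ici t₀)) (hT : t₀ ≤ T) {κ : ℝ}
    (hκ : ∀ t, T ≤ t → 0 < 1 + κ * quad (IPlusIntegrand a b t₀) (fundSol a x T) T t) :
    ∃ y, IsRegular a b c T y ∧ y T = x T + κ / J b t₀ T ∧ ∀ t, y t =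
      (κ / fundSol a x T t + (1 + κ * quad (IPlusIntegrand a b t₀) (fundSol a x T) T t) *
        coSol a b x t₀ T t) / (fundSol a x T t *
          (1 + κ * quad (IPlusIntegrand a b t₀) (fundSol a x T) T t) * J b t₀ t) := by
  refine ⟨_, ((h.linSol ha hb hT).reduction ((continuousOn_IPlusIntegrand ha hb).mono
    (Ici_subset_Ici.2 hT)) hκ).isRegular hb hT, ?_, fun t => rfl⟩
  have := (J_pos b t₀ T).ne'
  simp only [fundSol_self, quad, intervalIntegral.integral_same, coSol_self]
  field_simp
  ring

theorem IsRegular.eq_reduction (h : IsRegular a b c T x) (h' : IsRegular a b c T y)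
    (ha : ContinuousOn a (Ici t₀)) (hb : ContinuousOn b (Ici t₀)) (hT : t₀ ≤ T) {κ : ℝ}
    (hκ : κ = (y T - x T) * J b t₀ T) {t : ℝ} (ht : T ≤ t) :
    fundSol a y T t =
        fundSol a x T t * (1 + κ * quad (IPlusIntegrand a b t₀) (fundSol a x T) T t) ∧
      coSol a b y t₀ T t = κ / fundSol a x T t +
        (1 + κ * quad (IPlusIntegrand a b t₀) (fundSol a x T) T t) * coSol a b x t₀ T t := by
  have := (h.linSol ha hb hT).eq_reduction ((continuousOn_IPlusIntegrand ha hb).mono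
    (Ici_subset_Ici.2 hT)) (h'.linSol ha hb hT) (fundSol_self _ _ _) (fundSol_self _ _ _) ht
  rwa [coSol_self, coSol_self, ← sub_mul, ← hκ] at this

/-- Uniqueness is the reduction with `κ = 0`. -/
theorem IsRegular.eq_of_eq (h : IsRegular a b c T x) (h' : IsRegular a b c T y)
    (ha : ContinuousOn a (Ici t₀)) (hb : ContinuousOn b (Ici t₀)) (hT : t₀ ≤ T)
    (hxy : y T = x T) {t : ℝ} (ht : T ≤ t) : y t = x t := by
  obtain ⟨h1, h2⟩ := h.eq_reduction h' ha hb hT (κ := 0) (by simp [hxy]) ht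
  simp only [zero_mul, add_zero, mul_one, zero_div, one_mul, zero_add] at h1 h2
  rw [coSol, coSol, h1] at h2
  exact mul_right_cancel₀ (factor_pos a b x t₀ T t).ne' h2

theorem IsRegular.mem_reg_iff (h : IsRegular a b c T x) (ha : ContinuousOn a (Ici t₀))
    (hb : ContinuousOn b (Ici t₀)) (hT : t₀ ≤ T) {v : ℝ} :
    v ∈ reg a b c T ↔ ∀ t, T ≤ t →
      0 < 1 + (v - x T) * J b t₀ T * quad (IPlusIntegrand a b t₀) (fundSol a x T) T t := by
  constructor
  · rintro ⟨y, hy, rfl⟩ t ht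
    have h1 := (h.eq_reduction hy ha hb hT rfl ht).1
    have h2 := fundSol_pos a y T t
    rw [h1] at h2
    exact (mul_pos_iff_of_pos_left (fundSol_pos a x T t)).1 h2
  · intro hκ
    obtain ⟨y, hy, hyT, -⟩ := h.exists_reduction ha hb hT hκ
    refine ⟨y, hy, ?_⟩
    have := (J_pos b t₀ T).ne'
    rw [hyT]
    field_simp
    ring

theorem IsRegular.quad_nonneg (h : IsRegular a b c T x) (ha : ContinuousOn a (Ici t₀))
    (hb : ContinuousOn b (Ici t₀)) (hT : t₀ ≤ T) (ha0 : ∀ t, t₀ ≤ t → 0 ≤ a t) {t : ℝ}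
    (ht : T ≤ t) : 0 ≤ quad (IPlusIntegrand a b t₀) (fundSol a x T) T t :=
  (h.linSol ha hb hT).quad_nonneg (fun _ ht => IPlusIntegrand_nonneg ha0 (hT.trans ht)) ht

theorem IsRegular.mem_reg_of_le (h : IsRegular a b c T x) (ha : ContinuousOn a (Ici t₀))
    (hb : ContinuousOn b (Ici t₀)) (hT : t₀ ≤ T) (ha0 : ∀ t, t₀ ≤ t → 0 ≤ a t) {v : ℝ}
    (hv : x T ≤ v) : v ∈ reg a b c T := by
  refine (h.mem_reg_iff ha hb hT).2 fun t ht => ?_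
  have := mul_nonneg (mul_nonneg (sub_nonneg.2 hv) (J_pos b t₀ T).le)
    (h.quad_nonneg ha hb hT ha0 ht)
  linarith

/-- The set of regular initial values is a closed half-line. -/
theorem exists_least_regular (ha : ContinuousOn a (Ici t₀)) (hb : ContinuousOn b (Ici t₀))
    (ha0 : ∀ t, t₀ ≤ t → 0 ≤ a t) (hsupp : UnboundedSupport a t₀)
    (hreg : ∃ x, IsRegular a b c t₀ x) :
    ∃ xs, IsRegular a b c t₀ xs ∧ ∀ v, v ∈ reg a b c t₀ ↔ xs t₀ ≤ v := by
  obtain ⟨x, hx⟩ := hreg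
  have hA := continuousOn_IPlusIntegrand ha hb
  have hA0 : ∀ t, t₀ ≤ t → 0 ≤ IPlusIntegrand a b t₀ t := fun t ht => IPlusIntegrand_nonneg ha0 ht
  have S := hx.linSol ha hb le_rfl
  have hiff : ∀ v, v ∈ reg a b c t₀ ↔ ∀ t, t₀ ≤ t →
      0 < 1 + (v - x t₀) * quad (IPlusIntegrand a b t₀) (fundSol a x t₀) t₀ t := fun v => by
    rw [hx.mem_reg_iff ha hb le_rfl, J_self, mul_one]
  set q := quad (IPlusIntegrand a b t₀) (fundSol a x t₀) t₀ with hq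
  have hlow : ∀ t, t₀ ≤ t → 0 < q t → ∀ v ∈ reg a b c t₀, x t₀ - 1 / q t ≤ v := by
    intro t ht hqt v hv
    have h1 := (hiff v).1 hv t ht
    have h2 : -(1 / q t) ≤ v - x t₀ := by
      rw [neg_le, le_div_iff₀ hqt]
      linarith
    linarith
  have hne : (reg a b c t₀).Nonempty := ⟨x t₀, x, hx, rfl⟩
  have hbdd : BddBelow (reg a b c t₀) := by
    obtain ⟨t, ht, hlt⟩ := S.exists_quad_lt hA hA0 hsupp.IPlusIntegrand le_rfl
    exact ⟨_, fun v hv => hlow t ht ((S.quad_nonneg hA0 le_rfl).trans_lt hlt) v hv⟩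
  have hmem : sInf (reg a b c t₀) ∈ reg a b c t₀ := by
    refine (hiff _).2 fun t ht => ?_
    -- The infimum is regular because the bound from a later `u` with `q u > q t` makes the
    -- inequality at `t` strict.
    obtain ⟨u, hu, hlt⟩ := S.exists_quad_lt hA hA0 hsupp.IPlusIntegrand ht
    have h0 : 0 ≤ q t := S.quad_nonneg hA0 ht
    have hu0 : 0 < q u := h0.trans_lt hlt
    have h1 := le_csInf hne (hlow u (ht.trans hu) hu0)
    have h2 : -(1 / q u) * q t ≤ (sInf (reg a b c t₀) - x t₀) * q t :=
      mul_le_mul_of_nonneg_right (by linarith) h0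
    have h3 : q t / q u < 1 := (div_lt_one hu0).2 hlt
    have h4 : -(1 / q u) * q t = -(q t / q u) := by ring
    linarith
  obtain ⟨xs, hxs, hval⟩ := hmem
  refine ⟨xs, hxs, fun v => ⟨fun hv => hval ▸ csInf_le hbdd hv,
    hxs.mem_reg_of_le ha hb le_rfl ha0⟩⟩

theorem isNormal_iff {xs : ℝ → ℝ} (hxs : ∀ v, v ∈ reg a b c t₀ ↔ xs t₀ ≤ v) :
    IsNormal a b c t₀ x ↔ IsRegular a b c t₀ x ∧ xs t₀ < x t₀ := by
  have : reg a b c t₀ = Ici (xs t₀) := by ext v; exact hxs v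
  rw [IsNormal, exists_mem_subset_iff, this, ← mem_interior_iff_mem_nhds, interior_Ici, mem_Ioi]

/-- If `quad ≤ B`, the initial value could be lowered by `1 / (B + 1)` and stay regular. -/
theorem IsRegular.quad_unbounded {xs : ℝ → ℝ} (h : IsRegular a b c t₀ xs)
    (hxs : ∀ v, v ∈ reg a b c t₀ ↔ xs t₀ ≤ v) (ha : ContinuousOn a (Ici t₀))
    (hb : ContinuousOn b (Ici t₀)) (ha0 : ∀ t, t₀ ≤ t → 0 ≤ a t) (B : ℝ) :
    ∃ t, t₀ ≤ t ∧ B < quad (IPlusIntegrand a b t₀) (fundSol a xs t₀) t₀ t := by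
  by_contra! hcon
  have hB : 0 ≤ B := (h.quad_nonneg ha hb le_rfl ha0 le_rfl).trans (hcon t₀ le_rfl)
  have hmem : xs t₀ - 1 / (B + 1) ∈ reg a b c t₀ := by
    refine (h.mem_reg_iff ha hb le_rfl).2 fun t ht => ?_
    have h1 : 1 / (B + 1) * quad (IPlusIntegrand a b t₀) (fundSol a xs t₀) t₀ t < 1 := by
      rw [one_div, inv_mul_lt_iff₀ (by linarith)]
      linarith [hcon t ht]
    simp only [J_self, mul_one, sub_sub_cancel_left]
    linarith
  have := (hxs _).1 hmem
  have : 0 < 1 / (B + 1) := by positivity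
  linarith

/-- Regularity of the least value, tested from `x`, reads `(x t₀ - xs t₀) quad < 1`. -/
theorem IsRegular.quad_bounded {xs : ℝ → ℝ} (h : IsRegular a b c t₀ x)
    (hxs : ∀ v, v ∈ reg a b c t₀ ↔ xs t₀ ≤ v) (hlt : xs t₀ < x t₀)
    (ha : ContinuousOn a (Ici t₀)) (hb : ContinuousOn b (Ici t₀)) :
    ∃ B, ∀ t, t₀ ≤ t → quad (IPlusIntegrand a b t₀) (fundSol a x t₀) t₀ t ≤ B := by
  have h1 := (h.mem_reg_iff ha hb le_rfl).1 ((hxs _).2 le_rfl)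
  refine ⟨1 / (x t₀ - xs t₀), fun t ht => ?_⟩
  rw [le_div_iff₀ (by linarith)]
  have := h1 t ht
  simp only [J_self, mul_one] at this
  linarith

/-- Solutions slightly above a regular solution which has just become negative extend back to
the initial point. -/
theorem IsRegular.exists_backward (h : IsRegular a b c t₀ x) (ha : ContinuousOn a (Ici t₀))
    (hb : ContinuousOn b (Ici t₀)) (ha0 : ∀ t, t₀ ≤ t → 0 ≤ a t)
    (hc0 : ∀ t, t₀ ≤ t → 0 ≤ c t) {s : ℝ} (hs : t₀ ≤ s) (hneg : x s < 0) :
    ∃ t₁, t₀ ≤ t₁ ∧ (∀ t, t₁ ≤ t → x t < 0) ∧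
      ∀ v ∈ Ioo (x t₁) 0, ∃ y, IsRegular a b c t₀ y ∧ y t₁ = v := by
  have S := h.linSol ha hb le_rfl
  have hA := continuousOn_IPlusIntegrand ha hb
  set q := quad (IPlusIntegrand a b t₀) (fundSol a x t₀) t₀ with hq
  -- This product vanishes at `t₀`, where `q = 0`, and at the last zero of `x`. So `t₁` is `t₀` if
  -- `x` starts negative, and otherwise a point just after that zero.
  obtain ⟨t₁, ht₁, hneg₁, hsmall⟩ : ∃ t₁, t₀ ≤ t₁ ∧ (∀ t, t₁ ≤ t → x t < 0) ∧
      fundSol a x t₀ t₁ * q t₁ * (-coSol a b x t₀ t₀ t₁) < 1 := by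
    rcases lt_or_ge (x t₀) 0 with h0 | h0
    · refine ⟨t₀, le_rfl, fun t ht => IsSolutionOn.neg_of_neg h (convex_Ici t₀) Subset.rfl hb
        ha0 hc0 self_mem_Ici ht ht h0, by simp [hq, quad]⟩
    · obtain ⟨p, r, hp, -, -, hpr, -, hzero, hneg'⟩ := h.sign_pattern le_rfl hb ha0 hc0 h0 hs hneg
      have hr : t₀ ≤ r := hp.trans hpr
      have hcont : ContinuousWithinAt
          (fun t => fundSol a x t₀ t * q t * (-coSol a b x t₀ t₀ t)) (Ici t₀) r :=
        ((S.continuousOn_fst r hr).mul (S.hasDerivWithinAt_quad hA hr).continuousWithinAt).mul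
          (S.continuousOn_snd r hr).neg
      have hval : fundSol a x t₀ r * q r * (-coSol a b x t₀ t₀ r) < 1 := by
        simp [coSol, hzero r ⟨hpr, le_rfl⟩]
      have hev := (hcont.mono (Ioi_subset_Ici hr)).eventually (gt_mem_nhds hval)
      obtain ⟨t, ht1, ht2⟩ := (hev.and self_mem_nhdsWithin).exists
      exact ⟨t, hr.trans (le_of_lt ht2), fun u hu => hneg' u (lt_of_lt_of_le ht2 hu), ht1⟩
  refine ⟨t₁, ht₁, hneg₁, fun v hv => ?_⟩
  have hφ := fundSol_pos a x t₀ t₁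
  have hJ := J_pos b t₀ t₁
  have hq0 : 0 ≤ q t₁ := h.quad_nonneg ha hb le_rfl ha0 ht₁
  set φ := fundSol a x t₀ t₁ with hφdef
  set w := J b t₀ t₁ with hw
  set r := (v - x t₁) * (φ * w) with hr
  have hr0 : 0 < r := mul_pos (sub_pos.2 hv.1) (mul_pos hφ hJ)
  have hrz : r ≤ -coSol a b x t₀ t₀ t₁ := by
    rw [hr, coSol, ← hφdef, ← hw, ← neg_mul]
    exact mul_le_mul_of_nonneg_right (by linarith [hv.2]) (mul_pos hφ hJ).le
  have hden : 0 < 1 - φ * q t₁ * r := by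
    have := mul_le_mul_of_nonneg_left hrz (mul_nonneg hφ.le hq0)
    linarith
  have hκ0 : 0 < r * φ / (1 - φ * q t₁ * r) := div_pos (mul_pos hr0 hφ) hden
  -- This `κ` solves `κ / φ = r (1 + κ q)` at `t₁`, which says that the reduced solution takes the
  -- value `v` there; the smallness of the product makes it positive.
  set κ := r * φ / (1 - φ * q t₁ * r) with hκ
  have hpos : ∀ t, t₀ ≤ t → 0 < 1 + κ * q t := fun t ht => by
    have := mul_nonneg hκ0.le (h.quad_nonneg ha hb le_rfl ha0 ht)
    linarith
  obtain ⟨y, hy, -, hyt⟩ := h.exists_reduction ha hb le_rfl hpos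
  refine ⟨y, hy, ?_⟩
  have hκr : κ * (1 - φ * q t₁ * r) = r * φ := by
    rw [hκ]
    exact div_mul_cancel₀ _ hden.ne'
  rw [hyt t₁, ← hq, ← hφdef, ← hw, coSol, ← hφdef, ← hw, div_eq_iff
    (mul_pos (mul_pos hφ (hpos t₁ ht₁)) hJ).ne']
  have : κ / φ = r * (1 + κ * q t₁) := by
    rw [div_eq_iff hφ.ne']
    linarith
  rw [this, hr]
  ring

/-- The least solution which stays positive, when the integrals are small. -/
theorem IsRegular.exists_threshold (h : IsRegular a b c T x) (hT : t₀ ≤ T)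
    (ha : ContinuousOn a (Ici t₀))
    (hb : ContinuousOn b (Ici t₀)) (hc : ContinuousOn c (Ici t₀))
    (ha0 : ∀ t, t₀ ≤ t → 0 ≤ a t)
    (hc0 : ∀ t, t₀ ≤ t → 0 ≤ c t) (hsupp : UnboundedSupport c t₀) (hneg : x T < 0) {M N : ℝ}
    (hM : ∀ t, T ≤ t → ∫ s in T..t, IPlusIntegrand a b t₀ s ≤ M)
    (hN : ∀ t, T ≤ t → ∫ s in T..t, IPlusIntegrand c (fun s => -b s) t₀ s ≤ N)
    (hMN : M * N ≤ 1 / 2) :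
    ∃ y, IsRegular a b c T y ∧ (∀ t, T ≤ t → 0 < y t) ∧
      ∀ u, IsRegular a b c T u → u T ∈ Ioo 0 (y T) → ∃ s, T ≤ s ∧ u s < 0 := by
  have hsub := Ici_subset_Ici.2 hT
  have S := h.linSol ha hb hT
  have hA := (continuousOn_IPlusIntegrand ha hb).mono hsub
  have hC := (continuousOn_IPlusIntegrand hc hb.neg).mono hsub
  have hA0 : ∀ t, T ≤ t → 0 ≤ IPlusIntegrand a b t₀ t := fun t ht =>
    IPlusIntegrand_nonneg ha0 (hT.trans ht)
  have hC0 : ∀ t, T ≤ t → 0 ≤ IPlusIntegrand c (fun s => -b s) t₀ t := fun t ht =>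
    IPlusIntegrand_nonneg hc0 (hT.trans ht)
  have hN0 : 0 ≤ N := by simpa using hN T le_rfl
  set A := IPlusIntegrand a b t₀ with hAdef
  set C := IPlusIntegrand c (fun s => -b s) t₀ with hCdef
  set φ := fundSol a x T with hφ
  set z := coSol a b x t₀ T with hz
  set q := quad A φ T with hq
  have hφT : φ T = 1 := fundSol_self _ _ _
  have hqT : q T = 0 := by simp [hq, quad]
  have hzT : z T < 0 := coSol_neg_iff.2 hneg
  have hpos : ∀ κ, 0 ≤ κ → ∀ t, T ≤ t → 0 < 1 + κ * q t := fun κ hκ t ht => by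
    have := mul_nonneg hκ (h.quad_nonneg ha hb hT ha0 ht)
    linarith
  -- These are the `κ ≥ 0` whose reduction keeps its second component nonnegative; the least one
  -- gives the threshold.
  set P : Set ℝ := {κ | 0 ≤ κ ∧ ∀ t, T ≤ t → 0 ≤ κ / φ t + (1 + κ * q t) * z t} with hP
  have hclosed : IsClosed P := by
    have : P = Ici 0 ∩ ⋂ t, ⋂ (_ : T ≤ t), {κ | 0 ≤ κ / φ t + (1 + κ * q t) * z t} := by
      ext κ
      simp [hP]
    rw [this]
    refine isClosed_Ici.inter (isClosed_iInter fun t => isClosed_iInter fun _ =>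
      isClosed_le continuous_const (by fun_prop))
  have hne : P.Nonempty := by
    have hκ : 0 ≤ 2 * N - z T := by linarith
    -- With this `κ` the second component starts at `2 N` and the first at `1`, and `(1 + 2 N M) N ≤
    -- 2 N` since `M N ≤ 1/2`.
    refine ⟨2 * N - z T, hκ, fun t ht => (S.reduction hA (hpos _ hκ)).snd_nonneg_of_large hA hC
      hA0 hC0 hM hN ?_ ?_ ht⟩
    · simp only [← hq, hφT, hqT]
      linarith
    · simp only [← hq, hφT, hqT]
      nlinarith
  have hbdd : BddBelow P := ⟨0, fun κ hκ => hκ.1⟩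
  have hmem := hclosed.csInf_mem hne hbdd
  set κ := sInf P with hκ
  have R := S.reduction hA (hpos κ hmem.1)
  -- Nonnegativity improves to positivity: a zero would be followed by a negative value.
  have hRpos : ∀ t, T ≤ t → 0 < κ / φ t + (1 + κ * q t) * z t := by
    intro t ht
    by_contra! hcon
    obtain ⟨u, hu, hlt⟩ := R.exists_neg hC0 (hsupp.IPlusIntegrand.mono T) ht hcon
    exact (hmem.2 u (ht.trans hu)).not_gt hlt
  obtain ⟨y, hy, hyT, hyt⟩ := h.exists_reduction ha hb hT (hpos κ hmem.1)
  refine ⟨y, hy, fun t ht => ?_, fun u hu huT => ?_⟩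
  · rw [hyt t]
    exact div_pos (hRpos t ht) (mul_pos (R.pos t ht) (J_pos _ _ _))
  · by_contra! hcon
    have hJ := J_pos b t₀ T
    have hmem' : (u T - x T) * J b t₀ T ∈ P := by
      refine ⟨mul_nonneg (by linarith [huT.1]) hJ.le, fun t ht => ?_⟩
      rw [← (h.eq_reduction hu ha hb hT rfl ht).2]
      exact mul_nonneg (hcon t ht) (factor_pos _ _ _ _ _ _).le
    have h1 := csInf_le hbdd hmem'
    have h2 := huT.2
    rw [hyT, ← sub_lt_iff_lt_add', lt_div_iff₀ hJ] at h2
    linarith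

end Regular

end Riccati

/-! ### The main theorem. -/

theorem theorem2p4 (t₀ : ℝ) (a b c : ℝ → ℝ)
    (ha : ContinuousOn a (Set.Ici t₀)) (hb : ContinuousOn b (Set.Ici t₀))
    (hc : ContinuousOn c (Set.Ici t₀))
    (ha_nonneg : ∀ t, t₀ ≤ t → 0 ≤ a t) (hc_nonneg : ∀ t, t₀ ≤ t → 0 ≤ c t)
    (ha_supp : Riccati.UnboundedSupport a t₀) (hc_supp : Riccati.UnboundedSupport c t₀)
    (hreg : ∃ x, Riccati.IsRegular a b c t₀ x) :
    ∃ xs : ℝ → ℝ,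
      -- `xs` is the unique extremal solution
      Riccati.IsExtremal a b c t₀ xs ∧
      (∀ y, Riccati.IsExtremal a b c t₀ y → ∀ t, t₀ ≤ t → y t = xs t) ∧
      -- first case
      (Riccati.IntegralEqTop (Riccati.IPlusIntegrand a b t₀) t₀ →
        (∀ x, Riccati.IsRegular a b c t₀ x → ∀ t, t₀ ≤ t → 0 < x t) ∧
        (∀ x, Riccati.IsNormal a b c t₀ x →
          Riccati.IntegralEqTop (fun τ => a τ * x τ) t₀) ∧
        (Riccati.IntegralEqTop
            (fun τ => c τ * Riccati.IMinus (fun s => -b s) a t₀ τ) t₀ →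
          Riccati.IntegralEqTop (fun τ => a τ * xs τ) t₀)) ∧
      -- second case
      (Riccati.IntegralEqTop (Riccati.IPlusIntegrand c (fun s => -b s) t₀) t₀ →
        (∀ x, Riccati.IsRegular a b c t₀ x → 0 < x t₀ →
          ∃ t₁ t₂, t₀ < t₁ ∧ t₁ ≤ t₂ ∧ (∀ t ∈ Set.Ico t₀ t₁, 0 < x t) ∧
            (∀ t ∈ Set.Icc t₁ t₂, x t = 0) ∧ (∀ t, t₂ < t → x t < 0)) ∧
        (∀ x, Riccati.IsRegular a b c t₀ x → x t₀ = 0 →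
          ∃ t₁, t₀ ≤ t₁ ∧ (∀ t ∈ Set.Icc t₀ t₁, x t = 0) ∧ (∀ t, t₁ < t → x t < 0)) ∧
        (∀ x, Riccati.IsRegular a b c t₀ x → x t₀ < 0 → ∀ t, t₀ ≤ t → x t < 0) ∧
        Riccati.IntegralEqBot (fun τ => a τ * xs τ) t₀ ∧
        (Riccati.IntegralEqTop (fun τ => a τ * Riccati.IMinus b c t₀ τ) t₀ →
          ∀ x, Riccati.IsNormal a b c t₀ x →
            Riccati.IntegralEqBot (fun τ => a τ * x τ) t₀)) ∧
      -- third case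
      (Riccati.IntegralConverges (Riccati.IPlusIntegrand a b t₀) t₀ →
        Riccati.IntegralConverges (Riccati.IPlusIntegrand c (fun s => -b s) t₀) t₀ →
        (∃ t₁, t₀ ≤ t₁ ∧ (∀ t, t₁ ≤ t → xs t < 0) ∧
          -- solutions starting at `t₁` between `xs` and `0` extend to `[t₀, ∞)`
          (∀ v ∈ Set.Ioo (xs t₁) 0, ∃ x, Riccati.IsRegular a b c t₀ x ∧ x t₁ = v) ∧
          (∀ x, Riccati.IsRegular a b c t₁ x → x t₁ ∈ Set.Ioo (xs t₁) 0 →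
            ∀ t, t₁ ≤ t → x t < 0) ∧
          ∃ t₂, t₁ ≤ t₂ ∧
            Set.Ioo (xs t₂) 0 ⊆ Riccati.reg a b c t₂ ∧
            ∃ xN, Riccati.IsNormal a b c t₂ xN ∧ (∀ t, t₂ ≤ t → 0 < xN t) ∧
              Set.Ico 0 (xN t₂) ⊆ Riccati.reg a b c t₂ ∧
              (∀ x, Riccati.IsRegular a b c t₂ x → x t₂ ∈ Set.Ioo 0 (xN t₂) →
                ∃ t₃ t₄, t₂ < t₃ ∧ t₃ ≤ t₄ ∧ (∀ t ∈ Set.Ico t₂ t₃, 0 < x t) ∧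
                  (∀ t ∈ Set.Icc t₃ t₄, x t = 0) ∧ (∀ t, t₄ < t → x t < 0)) ∧
              (∀ x, Riccati.IsRegular a b c t₂ x → x t₂ = 0 →
                ∃ t₃, t₂ ≤ t₃ ∧ (∀ t ∈ Set.Icc t₂ t₃, x t = 0) ∧ (∀ t, t₃ < t → x t < 0)) ∧
              -- here `x` need not be global
              (∀ x T, Riccati.IsSolutionOn a b c x (Set.Ico t₂ T) → x t₂ < 0 →
                ∀ t ∈ Set.Ico t₂ T, x t < 0)) ∧
        (∀ x, Riccati.IsNormal a b c t₀ x →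
          Riccati.IntegralConverges (fun τ => a τ * x τ) t₀) ∧
        Riccati.IntegralEqBot (fun τ => a τ * xs τ) t₀) := by
  obtain ⟨xs, hxs, hmem⟩ := Riccati.exists_least_regular ha hb ha_nonneg ha_supp hreg
  have hnormal : ∀ x, Riccati.IsNormal a b c t₀ x ↔
      Riccati.IsRegular a b c t₀ x ∧ xs t₀ < x t₀ := fun x => Riccati.isNormal_iff hmem
  have hA := Riccati.continuousOn_IPlusIntegrand ha hb
  have hb' : ContinuousOn (fun s => -b s) (Ici t₀) := hb.neg
  have hC := Riccati.continuousOn_IPlusIntegrand hc hb'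
  have hA0 : ∀ t, t₀ ≤ t → 0 ≤ Riccati.IPlusIntegrand a b t₀ t := fun t ht =>
    Riccati.IPlusIntegrand_nonneg ha_nonneg ht
  have hC0 : ∀ t, t₀ ≤ t → 0 ≤ Riccati.IPlusIntegrand c (fun s => -b s) t₀ t := fun t ht =>
    Riccati.IPlusIntegrand_nonneg hc_nonneg ht
  have hCsupp := hc_supp.IPlusIntegrand (b := fun s => -b s)
  have lin := fun x (hx : Riccati.IsRegular a b c t₀ x) => hx.linSol ha hb le_rfl
  have hquad := hxs.quad_unbounded hmem ha hb ha_nonneg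
  have hneg : ∀ x T s t, t₀ ≤ T → Riccati.IsRegular a b c T x → T ≤ s → s ≤ t → x s < 0 →
      x t < 0 := fun x T s t hT hx hs hst h =>
    Riccati.IsSolutionOn.neg_of_neg hx (convex_Ici T) (Ici_subset_Ici.2 hT) hb ha_nonneg
      hc_nonneg hs (mem_Ici.2 (hs.trans hst)) hst h
  refine ⟨xs, ⟨hxs, fun h => lt_irrefl _ ((hnormal xs).1 h).2⟩, ?_, ?_, ?_, ?_⟩
  · rintro y ⟨hy, hyn⟩ t ht
    refine hxs.eq_of_eq hy ha hb le_rfl (le_antisymm ?_ ((hmem _).1 ⟨y, hy, rfl⟩)) ht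
    by_contra! hlt
    exact hyn ((hnormal y).2 ⟨hy, hlt⟩)
  · intro hI
    have hzpos : ∀ x, Riccati.IsRegular a b c t₀ x → ∀ t, t₀ ≤ t →
        0 < Riccati.coSol a b x t₀ t₀ t := fun x hx t ht =>
      (lin x hx).snd_pos hA hA0 hC0 hCsupp hI ht
    refine ⟨fun x hx t ht => Riccati.coSol_pos_iff.1 (hzpos x hx t ht), fun x hx => ?_,
      fun hI2 => ?_⟩
    · obtain ⟨hx, hlt⟩ := (hnormal x).1 hx
      obtain ⟨B, hB⟩ := hx.quad_bounded hmem hlt ha hb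
      exact Riccati.integralEqTop_of_fundSol
        ((lin x hx).tendsto_fst_atTop_of_quad_le hA hA0 (hzpos x hx) hI hB)
    · refine Riccati.integralEqTop_of_fundSol ((lin xs hxs).tendsto_fst_atTop_of_integral hA hC
        hA0 hC0 (hzpos xs hxs) (Riccati.fundSol_self _ _ _) (hI2.congr fun t ht => ?_))
      rw [Riccati.IMinus_eq hb' ht, Riccati.IPlusIntegrand_neg, Riccati.J_neg]
      simp only [neg_neg]
      rw [div_inv_eq_mul]
      ring
  · intro hI
    have hev : ∀ x, Riccati.IsRegular a b c t₀ x → ∃ s, t₀ ≤ s ∧ x s < 0 := fun x hx => by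
      obtain ⟨s, hs, h⟩ := (lin x hx).exists_snd_neg_of_integral hC hA0 hC0 hI
      exact ⟨s, hs, Riccati.coSol_neg_iff.1 h⟩
    refine ⟨fun x hx h0 => ?_, fun x hx h0 => ?_, fun x hx h0 t ht =>
      hneg x t₀ t₀ t le_rfl hx le_rfl ht h0, ?_, fun hI2 x hx => ?_⟩
    · obtain ⟨s, hs, h⟩ := hev x hx
      obtain ⟨p, q, -, h2, -, h4, h5, h6, h7⟩ :=
        hx.sign_pattern le_rfl hb ha_nonneg hc_nonneg h0.le hs h
      exact ⟨p, q, h2 h0, h4, h5, h6, h7⟩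
    · obtain ⟨s, hs, h⟩ := hev x hx
      obtain ⟨p, q, -, -, h3, h4, -, h6, h7⟩ :=
        hx.sign_pattern le_rfl hb ha_nonneg hc_nonneg h0.ge hs h
      obtain rfl := h3 h0
      exact ⟨q, h4, h6, h7⟩
    · obtain ⟨s, hs, h⟩ := hev xs hxs
      exact Riccati.integralEqBot_of_fundSol ((lin xs hxs).tendsto_fst_zero_of_quad hA hA0 hC0 hs
        (Riccati.coSol_neg_iff.2 h) hquad)
    · obtain ⟨s, hs, h⟩ := hev x hx.1
      refine Riccati.integralEqBot_of_fundSol ((lin x hx.1).tendsto_fst_zero_of_integral hA hC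
        hA0 hC0 hs (Riccati.coSol_neg_iff.2 h) (hI2.congr fun t ht => ?_))
      rw [Riccati.IMinus_eq hb ht, Riccati.IPlusIntegrand_eq_div]
      ring
  · intro hIA hIC
    obtain ⟨M, -, hM⟩ := hIA.exists_le hA hA0
    obtain ⟨N, hNlim, hN⟩ := hIC.exists_le hC hC0
    obtain ⟨s, hs, hzs⟩ := (lin xs hxs).exists_snd_neg_of_quad hA hA0 hM hquad
    have hxneg := Riccati.coSol_neg_iff.1 hzs
    refine ⟨?_, fun x hx => ?_, Riccati.integralEqBot_of_fundSol
      ((lin xs hxs).tendsto_fst_zero_of_quad hA hA0 hC0 hs hzs hquad)⟩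
    · obtain ⟨t₁, ht₁, hneg₁, hback⟩ :=
        hxs.exists_backward ha hb ha_nonneg hc_nonneg hs hxneg
      refine ⟨t₁, ht₁, hneg₁, hback, fun x hx hv t ht =>
        hneg x t₁ t₁ t ht₁ hx le_rfl ht hv.2, ?_⟩
      have hM0 : 0 ≤ M := by simpa using hM t₀ le_rfl
      -- `t₂` is taken so late that the tail of `∫ C` is at most `1 / (2 (M + 1))`, making its
      -- product with `M` at most `1/2`.
      have hδ : N - 1 / (2 * (M + 1)) < N := sub_lt_self _ (by positivity)
      obtain ⟨t₂, hNt₂, ht₁₂⟩ :=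
        ((hNlim.eventually (lt_mem_nhds hδ)).and (eventually_ge_atTop t₁)).exists
      have ht₂ := ht₁.trans ht₁₂
      have hxs₂ := hxs.mono ht₂
      have hMt : ∀ t, t₂ ≤ t → ∫ r in t₂..t, Riccati.IPlusIntegrand a b t₀ r ≤ M :=
        fun t ht => by
        have h1 := intervalIntegral.integral_add_adjacent_intervals
          (Riccati.intervalIntegrable_of_Ici hA le_rfl ht₂)
          (Riccati.intervalIntegrable_of_Ici hA ht₂ (ht₂.trans ht))
        have h2 := Riccati.integral_nonneg_Ici hA0 ht₂
        linarith [hM t (ht₂.trans ht)]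
      have hNt : ∀ t, t₂ ≤ t →
          ∫ r in t₂..t, Riccati.IPlusIntegrand c (fun s => -b s) t₀ r ≤ 1 / (2 * (M + 1)) :=
        fun t ht => by
        have h1 := intervalIntegral.integral_add_adjacent_intervals
          (Riccati.intervalIntegrable_of_Ici hC le_rfl ht₂)
          (Riccati.intervalIntegrable_of_Ici hC ht₂ (ht₂.trans ht))
        linarith [hN t (ht₂.trans ht)]
      have hMN : M * (1 / (2 * (M + 1))) ≤ 1 / 2 := by
        rw [mul_one_div, div_le_div_iff₀ (by positivity) (by positivity)]
        linarith
      obtain ⟨xN, hxN, hxNpos, hlow⟩ := hxs₂.exists_threshold ht₂ ha hb hc ha_nonneg hc_nonneg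
        hc_supp (hneg₁ t₂ ht₁₂) hMt hNt hMN
      have hreg₂ : Ici (xs t₂) ⊆ Riccati.reg a b c t₂ := fun v hv =>
        hxs₂.mem_reg_of_le ha hb ht₂ ha_nonneg hv
      have hlt₂ := hneg₁ t₂ ht₁₂
      refine ⟨t₂, ht₁₂, fun v hv => hreg₂ hv.1.le, xN,
        ⟨hxN, _, Ici_mem_nhds (hlt₂.trans (hxNpos t₂ le_rfl)), hreg₂⟩, hxNpos,
        fun v hv => hreg₂ (hlt₂.le.trans hv.1), fun x hx hv => ?_, fun x hx h0 => ?_,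
        fun x T hx h0 t ht => ?_⟩
      · obtain ⟨r, hr, h⟩ := hlow x hx hv
        obtain ⟨p, q, -, h2, -, h4, h5, h6, h7⟩ :=
          hx.sign_pattern ht₂ hb ha_nonneg hc_nonneg hv.1.le hr h
        exact ⟨p, q, h2 hv.1, h4, h5, h6, h7⟩
      -- A solution starting at zero must become negative, because `c` does not vanish identically
      -- near infinity.
      · have hz0 : Riccati.coSol a b x t₀ t₂ t₂ ≤ 0 := by simp [h0]
        obtain ⟨r, hr, h⟩ := (hx.linSol ha hb ht₂).exists_neg
          (fun t ht => hC0 t (ht₂.trans ht)) (hCsupp.mono t₂) le_rfl hz0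
        obtain ⟨p, q, -, -, h3, h4, -, h6, h7⟩ := hx.sign_pattern ht₂ hb ha_nonneg hc_nonneg
          h0.ge hr (Riccati.coSol_neg_iff.1 h)
        obtain rfl := h3 h0
        exact ⟨q, h4, h6, h7⟩
      · exact hx.neg_of_neg (convex_Ico t₂ T) (fun u hu => ht₂.trans hu.1) hb ha_nonneg
          hc_nonneg ⟨le_rfl, ht.1.trans_lt ht.2⟩ ht ht.1 h0
    · obtain ⟨hx, hlt⟩ := (hnormal x).1 hx
      obtain ⟨B, hB⟩ := hx.quad_bounded hmem hlt ha hb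
      obtain ⟨l, hl, hlim⟩ := (lin x hx).exists_tendsto_fst_pos hA hC hA0 hC0 hM hN hB
      exact Riccati.integralConverges_of_fundSol hl hlim
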